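/- Let $F_3$ be the Brown--Thompson group: the group of all order-preserving homeomorphisms of $[0,1]$ that map the intervals of one triadic subdivision of $[0,1]$ affinely, in order, onto the intervals of another triadic subdivision with equally many intervals, with product $f\cdot g=g\circ f$. A triadic subdivision is given by the leaves of a finite rooted planar ternary tree: the root is $[0,1]$ and the three children of a vertex are the left, middle and right thirds of its interval. So $f\in F_3$ is given by pairs $(T_+,T_-)$ of ternary trees ($T_+$ for the domain, $T_-$ for the range) with equally many leaves, and by exactly one reduced pair, that is, a pair from which no caret (three sibling leaves of $T_+$ matched with three sibling leaves of $T_-$) can be removed. For a finite word $\alpha$ in $\{0,1,2\}$ let $I_\alpha\subseteq[0,1]$ be the triadic interval reached from $[0,1]$ by passing successively to the left ($0$), middle ($1$) or right ($2$) third, and let $\psi_\alpha\colon I_\alpha\to[0,1]$ be the increasing affine bijection. For $f\in F_3$ let $\varphi_\alpha(f)\in F_3$ be the identity outside $I_\alpha$ and $\psi_\alpha^{-1}f\psi_\alpha$ on $I_\alpha$. For $f\in F_3$ let $\mathcal L(f)$ be the isotopy class of the (unoriented) link in $\mathbb R^3$ obtained by Jones' algorithm: take the reduced pair $(T_+,T_-)$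 of $f$, draw $T_+$ above and $T_-$ upside down below a line so that their $k$-th leaves coincide for all $k$, replace every $4$-valent vertex by a crossing in which the strand joining the left and the right child passes over the strand joining the parent and the middle child (in both trees), and close the diagram by an arc that joins the two roots. (With "under" in place of "over", for all vertices, one obtains the mirror images; the statement holds for either convention.) For $f,g\in F_3$ put $\sqcup(f,g):=\varphi_1(f)\,\varphi_0(g)$. Then: 1. $\varphi_1(f)\,\varphi_0(g)=\varphi_0(g)\,\varphi_1(f)$ for all $f,g\in F_3$. 2. If $f\neq 1$ and $g\neq 1$, then $\mathcal L(\sqcup(f,g))$ is the disjoint union of $\mathcal L(f)$ and $\mathcal L(g)$, i.e. the isotopy class of the union of a link in $\mathcal L(f)$ and a link in $\mathcal L(g)$ that lie on different sides of a plane. 3. $\sqcup(f\cdot f',\,g\cdot g')=\sqcup(f,g)\cdot\sqcup(f',g')$ for all $f,f',g,g'\in F_3$. -/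

import Mathlib

/-! ### Ternary trees and addresses -/

/-- Finite rooted planar ternary trees: every vertex is a leaf or has exactly three ordered
children. -/
inductive TernaryTree : Type
  | leaf : TernaryTree
  | node (l m r : TernaryTree) : TernaryTree

namespace TernaryTree

def numLeaves : TernaryTree → ℕ
  | leaf => 1
  | node l m r => l.numLeaves + m.numLeaves + r.numLeaves

/-- The addresses of the leaves, from left to right. An address is the path from the root, with
`0` for left, `1` for straight on and `2` for right. -/
def leaves : TernaryTree → List (List (Fin 3))
  | leaf => [[]]
  | node l m r =>
      l.leaves.map (List.cons 0) ++ m.leaves.map (List.cons 1) ++ r.leaves.map (List.cons 2)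

/-- `AddCaret i T T'`: the tree `T'` arises from `T` by attaching a caret (a vertex with three
leaves) at the `i`-th leaf of `T`, leaves being counted from `0` from left to right. -/
inductive AddCaret : ℕ → TernaryTree → TernaryTree → Prop
  | here : AddCaret 0 leaf (node leaf leaf leaf)
  | left (i : ℕ) (l l' m r : TernaryTree) :
      AddCaret i l l' → AddCaret i (node l m r) (node l' m r)
  | mid (i : ℕ) (l m m' r : TernaryTree) :
      AddCaret i m m' → AddCaret (l.numLeaves + i) (node l m r) (node l m' r)
  | right (i : ℕ) (l m r r' : TernaryTree) :
      AddCaret i r r' → AddCaret (l.numLeaves + m.numLeaves + i) (node l m r) (node l m r')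

/-- A pair of trees is reduced if no caret can be removed from it, that is, if it does not arise
by attaching carets at the `i`-th leaves of both trees of another pair. -/
def Reduced (T S : TernaryTree) : Prop :=
  ¬ ∃ (i : ℕ) (T' S' : TernaryTree), AddCaret i T' T ∧ AddCaret i S' S

end TernaryTree

/-- The affine map of `[0,1]` onto its `i`-th third, for `i = 0, 1, 2`. -/
noncomputable def third (i : Fin 3) (s : unitInterval) : unitInterval :=
  ⟨(((i : ℕ) : ℝ) + s) / 3, by
    have h0 := s.2.1
    have h1 := s.2.2
    have h2 : (((i : ℕ) : ℝ)) ≤ 2 := by exact_mod_cast Nat.le_of_lt_succ i.2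
    have h3 : (0 : ℝ) ≤ ((i : ℕ) : ℝ) := Nat.cast_nonneg _
    constructor <;> linarith⟩

/-- The increasing affine map of `[0,1]` onto the triadic interval `I_α` of the address `α`.
It is the inverse of the linear isomorphism `ψ_α : I_α → [0,1]`. -/
noncomputable def place : List (Fin 3) → unitInterval → unitInterval
  | [], s => s
  | i :: α, s => third i (place α s)

/-- The order preserving homeomorphism `f` of `[0,1]` is represented by the pair of trees `(T, S)`:
the trees have the same number of leaves, and `f` maps the interval of the `k`-th leaf of `T`
affinely onto the interval of the `k`-th leaf of `S`, for all `k`. -/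
def Represents (f : unitInterval ≃o unitInterval) (T S : TernaryTree) : Prop :=
  List.Forall₂ (fun α β => ∀ s : unitInterval, f (place α s) = place β s) T.leaves S.leaves

/-! ### Facts on trees needed for the group structure -/

namespace TernaryTree

/-- `Grafts T ts T'`: the tree `T'` arises from `T` by attaching the trees of the list `ts` at the
leaves of `T`. -/
inductive Grafts : TernaryTree → List TernaryTree → TernaryTree → Prop
  | leaf (t : TernaryTree) : Grafts leaf [t] t
  | node (l m r l' m' r' : TernaryTree) (tl tm tr : List TernaryTree) :
      Grafts l tl l' → Grafts m tm m' → Grafts r tr r' →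
      Grafts (node l m r) (tl ++ tm ++ tr) (node l' m' r')

theorem length_leaves (T : TernaryTree) : T.leaves.length = T.numLeaves := by
  induction T with
  | leaf => rfl
  | node l m r hl hm hr => simp [leaves, numLeaves, hl, hm, hr, Nat.add_assoc]

theorem Grafts.length {T T' : TernaryTree} {ts : List TernaryTree} (h : Grafts T ts T') :
    ts.length = T.numLeaves := by
  induction h with
  | leaf t => rfl
  | node l m r l' m' r' tl tm tr _ _ _ h1 h2 h3 => simp [numLeaves, h1, h2, h3, Nat.add_assoc]

theorem exists_grafts (T : TernaryTree) :
    ∀ ts : List TernaryTree, ts.length = T.numLeaves → ∃ T', Grafts T ts T' := by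
  induction T with
  | leaf =>
    intro ts h
    obtain ⟨t, rfl⟩ := List.length_eq_one_iff.1 h
    exact ⟨t, Grafts.leaf t⟩
  | node l m r hl hm hr =>
    intro ts h
    simp only [numLeaves] at h
    obtain ⟨l', h1⟩ := hl (ts.take l.numLeaves) (by rw [List.length_take]; omega)
    obtain ⟨m', h2⟩ := hm ((ts.drop l.numLeaves).take m.numLeaves)
      (by rw [List.length_take, List.length_drop]; omega)
    obtain ⟨r', h3⟩ := hr ((ts.drop l.numLeaves).drop m.numLeaves)
      (by rw [List.length_drop, List.length_drop]; omega)
    refine ⟨TernaryTree.node l' m' r', ?_⟩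
    have h4 := Grafts.node _ _ _ _ _ _ _ _ _ h1 h2 h3
    rwa [List.append_assoc, List.take_append_drop, List.take_append_drop] at h4

theorem grafts_leaves (T : TernaryTree) : ∃ ts, Grafts T ts T := by
  induction T with
  | leaf => exact ⟨_, Grafts.leaf _⟩
  | node l m r hl hm hr =>
    obtain ⟨a, ha⟩ := hl
    obtain ⟨b, hb⟩ := hm
    obtain ⟨c, hc⟩ := hr
    exact ⟨_, Grafts.node _ _ _ _ _ _ _ _ _ ha hb hc⟩

/-- Two trees have a common refinement. -/
theorem exists_common (T : TernaryTree) :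
    ∀ S : TernaryTree, ∃ U ts ss, Grafts T ts U ∧ Grafts S ss U := by
  induction T with
  | leaf =>
    intro S
    obtain ⟨ss, hs⟩ := grafts_leaves S
    exact ⟨S, _, ss, Grafts.leaf S, hs⟩
  | node l m r hl hm hr =>
    intro S
    cases S with
    | leaf =>
      obtain ⟨ts, ht⟩ := grafts_leaves (TernaryTree.node l m r)
      exact ⟨_, ts, _, ht, Grafts.leaf _⟩
    | node l₂ m₂ r₂ =>
      obtain ⟨u, a, b, h1, h2⟩ := hl l₂
      obtain ⟨v, c, d, h3, h4⟩ := hm m₂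
      obtain ⟨w, e, k, h5, h6⟩ := hr r₂
      exact ⟨_, _, _, Grafts.node _ _ _ _ _ _ _ _ _ h1 h3 h5,
        Grafts.node _ _ _ _ _ _ _ _ _ h2 h4 h6⟩

theorem Grafts.leaves_eq {T T' : TernaryTree} {ts : List TernaryTree} (h : Grafts T ts T') :
    T'.leaves = (List.zipWith (fun α t => t.leaves.map (α ++ ·)) T.leaves ts).flatten := by
  induction h with
  | leaf t => simp [leaves]
  | node l m r l' m' r' tl tm tr g1 g2 g3 h1 h2 h3 =>
    have e1 := g1.length
    have e2 := g2.length
    simp only [leaves]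
    rw [List.zipWith_append (by simp [length_leaves, e1, e2]),
      List.zipWith_append (by simp [length_leaves, e1]), h1, h2, h3]
    simp [List.map_flatten, List.zipWith_map_left, List.map_zipWith, Function.comp_def]

theorem AddCaret.leaves_eq {i : ℕ} {T T' : TernaryTree} (h : AddCaret i T T') :
    ∃ A α B, A.length = i ∧ T.leaves = A ++ [α] ++ B ∧
      T'.leaves = A ++ [α ++ [0], α ++ [1], α ++ [2]] ++ B := by
  induction h with
  | here => exact ⟨[], [], [], rfl, rfl, rfl⟩
  | left i l l' m r _ ih =>
    obtain ⟨A, α, B, h1, h2, h3⟩ := ih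
    exact ⟨A.map (List.cons 0), 0 :: α,
      B.map (List.cons 0) ++ m.leaves.map (List.cons 1) ++ r.leaves.map (List.cons 2),
      by simp [h1], by simp [leaves, h2], by simp [leaves, h3]⟩
  | mid i l m m' r _ ih =>
    obtain ⟨A, α, B, h1, h2, h3⟩ := ih
    exact ⟨l.leaves.map (List.cons 0) ++ A.map (List.cons 1), 1 :: α,
      B.map (List.cons 1) ++ r.leaves.map (List.cons 2),
      by simp [h1, length_leaves], by simp [leaves, h2], by simp [leaves, h3]⟩
  | right i l m r r' _ ih =>
    obtain ⟨A, α, B, h1, h2, h3⟩ := ih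
    exact ⟨l.leaves.map (List.cons 0) ++ m.leaves.map (List.cons 1) ++ A.map (List.cons 2),
      2 :: α, B.map (List.cons 2),
      by simp [h1, length_leaves, Nat.add_assoc], by simp [leaves, h2], by simp [leaves, h3]⟩

end TernaryTree

/-! ### Facts on triadic intervals -/

theorem third_strictMono (i : Fin 3) : StrictMono (third i) := by
  intro s t h
  have h' : (s : ℝ) < t := h
  change (((i : ℕ) : ℝ) + s) / 3 < (((i : ℕ) : ℝ) + t) / 3
  linarith

theorem exists_third (t : unitInterval) : ∃ i s, third i s = t := by
  have h0 := t.2.1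
  have h1 := t.2.2
  rcases le_total (t : ℝ) (1 / 3) with h | h
  · refine ⟨0, ⟨3 * t, by linarith, by linarith⟩, Subtype.ext ?_⟩
    simp [third]
  · rcases le_total (t : ℝ) (2 / 3) with h' | h'
    · refine ⟨1, ⟨3 * t - 1, by linarith, by linarith⟩, Subtype.ext ?_⟩
      simp [third]
    · refine ⟨2, ⟨3 * t - 2, by linarith, by linarith⟩, Subtype.ext ?_⟩
      simp [third]

theorem exists_third_of_mem (i : Fin 3) (t : unitInterval)
    (h : t ∈ Set.Icc (third i 0) (third i 1)) : ∃ s, third i s = t := by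
  have h0 : (((i : ℕ) : ℝ) + 0) / 3 ≤ t := h.1
  have h1 : (t : ℝ) ≤ (((i : ℕ) : ℝ) + 1) / 3 := h.2
  refine ⟨⟨3 * t - ((i : ℕ) : ℝ), by linarith, by linarith⟩, Subtype.ext ?_⟩
  simp [third]

theorem place_strictMono (α : List (Fin 3)) : StrictMono (place α) := by
  induction α with
  | nil => exact strictMono_id
  | cons i α ih => exact (third_strictMono i).comp ih

theorem place_append (α β : List (Fin 3)) (s : unitInterval) :
    place (α ++ β) s = place α (place β s) := by
  induction α with
  | nil => rfl
  | cons i α ih => simp [place, ih]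

theorem exists_place_of_mem (α : List (Fin 3)) :
    ∀ t ∈ Set.Icc (place α 0) (place α 1), ∃ s, place α s = t := by
  induction α with
  | nil => exact fun t _ => ⟨t, rfl⟩
  | cons i α ih =>
    intro t ht
    obtain ⟨s, rfl⟩ := exists_third_of_mem i t
      ⟨((third_strictMono i).monotone (unitInterval.nonneg' (t := _))).trans ht.1,
        ht.2.trans ((third_strictMono i).monotone (unitInterval.le_one' (t := _)))⟩
    obtain ⟨s', rfl⟩ := ih s
      ⟨(third_strictMono i).le_iff_le.1 ht.1, (third_strictMono i).le_iff_le.1 ht.2⟩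
    exact ⟨s', rfl⟩

/-! ### Facts on representing pairs of trees -/

theorem represents_refl (T : TernaryTree) : Represents (OrderIso.refl _) T T :=
  List.forall₂_same.2 fun _ _ _ => rfl

theorem Represents.symm {f : unitInterval ≃o unitInterval} {T S : TernaryTree}
    (h : Represents f T S) : Represents f.symm S T := by
  refine (List.Forall₂.flip h).imp ?_
  intro α β h s
  rw [← h s, OrderIso.symm_apply_apply]

theorem forall₂_trans {A B C : List (List (Fin 3))} {f g : unitInterval ≃o unitInterval}
    (h1 : List.Forall₂ (fun α β => ∀ s, f (place α s) = place β s) A B)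
    (h2 : List.Forall₂ (fun α β => ∀ s, g (place α s) = place β s) B C) :
    List.Forall₂ (fun α β => ∀ s, (f.trans g) (place α s) = place β s) A C := by
  induction h1 generalizing C with
  | nil => cases h2; exact List.Forall₂.nil
  | cons h _ ih =>
    cases h2 with
    | cons h' h'' =>
      exact List.Forall₂.cons (fun s => by rw [OrderIso.trans_apply, h s, h' s]) (ih h'')

theorem forall₂_flatten {f : unitInterval ≃o unitInterval} {A B : List (List (Fin 3))}
    (h : List.Forall₂ (fun α β => ∀ s, f (place α s) = place β s) A B) :
    ∀ ts : List TernaryTree,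
    List.Forall₂ (fun α β => ∀ s, f (place α s) = place β s)
      (List.zipWith (fun α t => t.leaves.map (α ++ ·)) A ts).flatten
      (List.zipWith (fun α t => t.leaves.map (α ++ ·)) B ts).flatten := by
  induction h with
  | nil => simp
  | @cons α β A B h _ ih =>
    intro ts
    cases ts with
    | nil => simp
    | cons t ts =>
      simp only [List.zipWith_cons_cons, List.flatten_cons]
      refine List.rel_append ?_ (ih ts)
      rw [List.forall₂_map_left_iff, List.forall₂_map_right_iff]
      refine List.forall₂_same.2 fun γ _ s => ?_
      rw [place_append, place_append, h]

/-- A representing pair may be refined so that its second tree is a given refinement. -/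
theorem Represents.refine {f : unitInterval ≃o unitInterval} {T S U : TernaryTree}
    {ts : List TernaryTree} (h : Represents f T S) (hU : S.Grafts ts U) :
    ∃ T', Represents f T' U := by
  have hl : ts.length = T.numLeaves := by
    rw [hU.length, ← TernaryTree.length_leaves, ← TernaryTree.length_leaves]
    exact (List.Forall₂.length_eq h).symm
  obtain ⟨T', hT⟩ := TernaryTree.exists_grafts T ts hl
  refine ⟨T', ?_⟩
  unfold Represents
  rw [hT.leaves_eq, hU.leaves_eq]
  exact forall₂_flatten h ts

theorem Represents.trans {f g : unitInterval ≃o unitInterval} {T S S' U : TernaryTree}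
    (h : Represents f T S) (h' : Represents g S' U) :
    ∃ T' U', Represents (f.trans g) T' U' := by
  obtain ⟨V, ts, ss, h1, h2⟩ := TernaryTree.exists_common S S'
  obtain ⟨T', h3⟩ := h.refine h1
  obtain ⟨U', h4⟩ := h'.symm.refine h2
  exact ⟨T', U', forall₂_trans h3 h4.symm⟩

theorem Represents.removeCaret {f : unitInterval ≃o unitInterval} {i : ℕ}
    {T S T' S' : TernaryTree} (h : Represents f T S) (hT : TernaryTree.AddCaret i T' T)
    (hS : TernaryTree.AddCaret i S' S) :
    Represents f T' S' ∧ T'.leaves.length < T.leaves.length := by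
  obtain ⟨A, α, B, hA, h1, h2⟩ := hT.leaves_eq
  obtain ⟨A', β, B', hA', h3, h4⟩ := hS.leaves_eq
  unfold Represents at h ⊢
  rw [h2, h4, List.append_assoc, List.append_assoc] at h
  have e1 := List.forall₂_take A.length h
  have e2 := List.forall₂_drop A.length h
  have hAA : A.length = A'.length := hA.trans hA'.symm
  rw [List.take_left, hAA, List.take_left] at e1
  rw [List.drop_left, hAA, List.drop_left] at e2
  simp only [List.cons_append, List.nil_append, List.forall₂_cons] at e2
  obtain ⟨c0, c1, c2, e3⟩ := e2
  refine ⟨?_, by rw [h1, h2]; simp⟩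
  rw [h1, h3, List.append_assoc, List.append_assoc]
  refine List.rel_append e1 (List.Forall₂.cons ?_ e3)
  intro s
  obtain ⟨j, u, rfl⟩ := exists_third s
  fin_cases j
  · simpa [place_append, place] using c0 u
  · simpa [place_append, place] using c1 u
  · simpa [place_append, place] using c2 u

theorem exists_reduced (f : unitInterval ≃o unitInterval) :
    ∀ (n : ℕ) (T S : TernaryTree), T.leaves.length = n → Represents f T S →
      ∃ T' S', Represents f T' S' ∧ TernaryTree.Reduced T' S' := by
  intro n
  induction n using Nat.strong_induction_on with
  | _ n ih =>
    intro T S hn h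
    by_cases hr : TernaryTree.Reduced T S
    · exact ⟨T, S, h, hr⟩
    · obtain ⟨i, T', S', hT, hS⟩ := not_not.1 hr
      obtain ⟨h', hlt⟩ := h.removeCaret hT hS
      exact ih _ (hn ▸ hlt) T' S' rfl h'

/-! ### The Brown–Thompson group -/

/-- The Brown–Thompson group `F₃`: the order preserving homeomorphisms of `[0,1]` that map the
intervals of one triadic subdivision affinely onto those of another one. -/
@[ext]
structure F3 where
  toOrderIso : unitInterval ≃o unitInterval
  exists_represents : ∃ T S : TernaryTree, Represents toOrderIso T S

namespace F3

/-- Products are read from left to right: `f * g` is first `f`, then `g`. -/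
instance : Mul F3 where
  mul f g := ⟨f.toOrderIso.trans g.toOrderIso, by
    obtain ⟨T, S, h⟩ := f.exists_represents
    obtain ⟨S', U, h'⟩ := g.exists_represents
    exact h.trans h'⟩

instance : One F3 where
  one := ⟨OrderIso.refl _, TernaryTree.leaf, TernaryTree.leaf, represents_refl _⟩

instance : Inv F3 where
  inv f := ⟨f.toOrderIso.symm, by
    obtain ⟨T, S, h⟩ := f.exists_represents
    exact ⟨S, T, h.symm⟩⟩

instance : Group F3 :=
  Group.ofLeftAxioms (fun _ _ _ => rfl) (fun _ => rfl)
    (fun f => F3.ext (OrderIso.symm_trans_self f.toOrderIso))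

theorem exists_reducedPair (f : F3) :
    ∃ P : TernaryTree × TernaryTree,
      Represents f.toOrderIso P.1 P.2 ∧ TernaryTree.Reduced P.1 P.2 := by
  obtain ⟨T, S, h⟩ := f.exists_represents
  obtain ⟨T', S', h1, h2⟩ := exists_reduced f.toOrderIso _ T S rfl h
  exact ⟨(T', S'), h1, h2⟩

/-- The reduced pair of trees `(T₊, T₋)` of `f`. -/
noncomputable def reducedPair (f : F3) : TernaryTree × TernaryTree :=
  Classical.choose f.exists_reducedPair

/-! ### The maps `φ_α` and the operation `⊔` -/

/-- The map that is the identity outside `I_α` and is `ψ_α⁻¹ f ψ_α` on `I_α`. -/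
noncomputable def phiFun (α : List (Fin 3)) (f : unitInterval ≃o unitInterval) :
    unitInterval → unitInterval :=
  Function.extend (place α) (place α ∘ f) id

theorem phiFun_place (α : List (Fin 3)) (f : unitInterval ≃o unitInterval) (s : unitInterval) :
    phiFun α f (place α s) = place α (f s) :=
  (place_strictMono α).injective.extend_apply _ _ _

theorem phiFun_of_notMem (α : List (Fin 3)) (f : unitInterval ≃o unitInterval)
    {t : unitInterval} (h : ¬ ∃ s, place α s = t) : phiFun α f t = t :=
  Function.extend_apply' _ _ _ h

theorem phiFun_symm (α : List (Fin 3)) (f : unitInterval ≃o unitInterval) (t : unitInterval) :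
    phiFun α f.symm (phiFun α f t) = t := by
  by_cases h : ∃ s, place α s = t
  · obtain ⟨s, rfl⟩ := h
    rw [phiFun_place, phiFun_place, OrderIso.symm_apply_apply]
  · rw [phiFun_of_notMem α f h, phiFun_of_notMem α _ h]

theorem phiFun_monotone (α : List (Fin 3)) (f : unitInterval ≃o unitInterval) :
    Monotone (phiFun α f) := by
  have lo : ∀ s, place α 0 ≤ place α s := fun s =>
    (place_strictMono α).monotone unitInterval.nonneg'
  have hi : ∀ s, place α s ≤ place α 1 := fun s =>
    (place_strictMono α).monotone unitInterval.le_one'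
  intro x y hxy
  by_cases hx : ∃ s, place α s = x
  · obtain ⟨s, rfl⟩ := hx
    by_cases hy : ∃ u, place α u = y
    · obtain ⟨u, rfl⟩ := hy
      rw [phiFun_place, phiFun_place]
      exact (place_strictMono α).monotone
        (f.monotone ((place_strictMono α).le_iff_le.1 hxy))
    · rw [phiFun_place, phiFun_of_notMem α f hy]
      refine (hi _).trans (le_of_not_ge fun h => hy ?_)
      exact exists_place_of_mem α y ⟨(lo s).trans hxy, h⟩
  · rw [phiFun_of_notMem α f hx]
    by_cases hy : ∃ u, place α u = y
    · obtain ⟨u, rfl⟩ := hy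
      rw [phiFun_place]
      refine le_trans (le_of_not_ge fun h => hx ?_) (lo _)
      exact exists_place_of_mem α x ⟨h, hxy.trans (hi u)⟩
    · rwa [phiFun_of_notMem α f hy]

noncomputable def phiIso (α : List (Fin 3)) (f : unitInterval ≃o unitInterval) :
    unitInterval ≃o unitInterval where
  toFun := phiFun α f
  invFun := phiFun α f.symm
  left_inv := phiFun_symm α f
  right_inv t := by simpa using phiFun_symm α f.symm t
  map_rel_iff' := by
    intro x y
    refine ⟨fun h => ?_, fun h => phiFun_monotone α f h⟩
    have h' : phiFun α f.symm (phiFun α f x) ≤ phiFun α f.symm (phiFun α f y) :=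
      phiFun_monotone α f.symm h
    rwa [phiFun_symm, phiFun_symm] at h'

end F3

namespace TernaryTree

/-- The tree that consists of the path `α` with the tree `T` attached at its end. -/
def attachAt : List (Fin 3) → TernaryTree → TernaryTree
  | [], T => T
  | 0 :: α, T => node (attachAt α T) leaf leaf
  | 1 :: α, T => node leaf (attachAt α T) leaf
  | 2 :: α, T => node leaf leaf (attachAt α T)

/-- Apart from the leaves of `T`, the leaves of `attachAt α T` depend on `α` only and lie to the
left or to the right of `I_α`. -/
theorem leaves_attachAt (α : List (Fin 3)) :
    ∃ A B, (∀ T, (attachAt α T).leaves = A ++ T.leaves.map (α ++ ·) ++ B) ∧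
      (∀ β ∈ A, ∀ s, place β s ≤ place α 0) ∧ (∀ β ∈ B, ∀ s, place α 1 ≤ place β s) := by
  have key : ∀ (i j : Fin 3), i < j → ∀ s t, third i s ≤ third j t := by
    intro i j hij s t
    have h : ((i : ℕ) : ℝ) + 1 ≤ ((j : ℕ) : ℝ) := by exact_mod_cast hij
    have h1 := s.2.2
    have h2 := t.2.1
    change (((i : ℕ) : ℝ) + s) / 3 ≤ (((j : ℕ) : ℝ) + t) / 3
    linarith
  induction α with
  | nil => exact ⟨[], [], by simp [attachAt], by simp, by simp⟩
  | cons i α ih =>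
    obtain ⟨A, B, h, hA, hB⟩ := ih
    fin_cases i
    · refine ⟨A.map (List.cons 0), B.map (List.cons 0) ++ [[1], [2]],
        by simp [attachAt, leaves, h, Function.comp_def], ?_, ?_⟩
      · intro β hβ s
        obtain ⟨γ, hγ, rfl⟩ := List.mem_map.1 hβ
        exact (third_strictMono 0).monotone (hA γ hγ s)
      · intro β hβ s
        rcases List.mem_append.1 hβ with hβ | hβ
        · obtain ⟨γ, hγ, rfl⟩ := List.mem_map.1 hβ
          exact (third_strictMono 0).monotone (hB γ hγ s)
        · simp only [List.mem_cons, List.not_mem_nil, or_false] at hβ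
          rcases hβ with rfl | rfl
          · exact key 0 1 (by decide) _ _
          · exact key 0 2 (by decide) _ _
    · refine ⟨[0] :: A.map (List.cons 1), B.map (List.cons 1) ++ [[2]],
        by simp [attachAt, leaves, h, Function.comp_def], ?_, ?_⟩
      · intro β hβ s
        rcases List.mem_cons.1 hβ with rfl | hβ
        · exact key 0 1 (by decide) _ _
        · obtain ⟨γ, hγ, rfl⟩ := List.mem_map.1 hβ
          exact (third_strictMono 1).monotone (hA γ hγ s)
      · intro β hβ s
        rcases List.mem_append.1 hβ with hβ | hβ
        · obtain ⟨γ, hγ, rfl⟩ := List.mem_map.1 hβ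
          exact (third_strictMono 1).monotone (hB γ hγ s)
        · obtain rfl := List.mem_singleton.1 hβ
          exact key 1 2 (by decide) _ _
    · refine ⟨[0] :: [1] :: A.map (List.cons 2), B.map (List.cons 2),
        by simp [attachAt, leaves, h, Function.comp_def], ?_, ?_⟩
      · intro β hβ s
        simp only [List.mem_cons] at hβ
        rcases hβ with rfl | rfl | hβ
        · exact key 0 2 (by decide) _ _
        · exact key 1 2 (by decide) _ _
        · obtain ⟨γ, hγ, rfl⟩ := List.mem_map.1 hβ
          exact (third_strictMono 2).monotone (hA γ hγ s)
      · intro β hβ s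
        obtain ⟨γ, hγ, rfl⟩ := List.mem_map.1 hβ
        exact (third_strictMono 2).monotone (hB γ hγ s)

end TernaryTree

namespace F3

theorem phiFun_of_le (α : List (Fin 3)) (f : unitInterval ≃o unitInterval) {t : unitInterval}
    (h : t ≤ place α 0) : phiFun α f t = t := by
  by_cases ht : ∃ s, place α s = t
  · obtain ⟨s, rfl⟩ := ht
    obtain rfl : s = 0 := le_antisymm ((place_strictMono α).le_iff_le.1 h) unitInterval.nonneg'
    rw [phiFun_place]
    congr 1
    exact f.map_bot
  · exact phiFun_of_notMem α f ht

theorem phiFun_of_ge (α : List (Fin 3)) (f : unitInterval ≃o unitInterval) {t : unitInterval}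
    (h : place α 1 ≤ t) : phiFun α f t = t := by
  by_cases ht : ∃ s, place α s = t
  · obtain ⟨s, rfl⟩ := ht
    obtain rfl : s = 1 := le_antisymm unitInterval.le_one' ((place_strictMono α).le_iff_le.1 h)
    rw [phiFun_place]
    congr 1
    exact f.map_top
  · exact phiFun_of_notMem α f ht

theorem represents_phiIso (α : List (Fin 3)) {f : unitInterval ≃o unitInterval}
    {T S : TernaryTree} (h : Represents f T S) :
    ∃ T' S', Represents (phiIso α f) T' S' := by
  obtain ⟨A, B, h0, hA, hB⟩ := TernaryTree.leaves_attachAt α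
  refine ⟨TernaryTree.attachAt α T, TernaryTree.attachAt α S, ?_⟩
  unfold Represents
  rw [h0, h0]
  refine List.rel_append (List.rel_append ?_ ?_) ?_
  · exact List.forall₂_same.2 fun β hβ s => phiFun_of_le α f (hA β hβ s)
  · rw [List.forall₂_map_left_iff, List.forall₂_map_right_iff]
    refine List.Forall₂.imp ?_ h
    intro β γ hβ s
    rw [place_append, place_append, ← hβ s]
    exact phiFun_place α f _
  · exact List.forall₂_same.2 fun β hβ s => phiFun_of_ge α f (hB β hβ s)

/-- The map `φ_α : F₃ → F₃`. -/
noncomputable def phi (α : List (Fin 3)) (f : F3) : F3 :=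
  ⟨phiIso α f.toOrderIso, by
    obtain ⟨T, S, h⟩ := f.exists_represents
    exact represents_phiIso α h⟩

/-- The operation `⊔(f, g) = φ₁(f) φ₀(g)`. -/
noncomputable def sqcup (f g : F3) : F3 := phi [1] f * phi [0] g

end F3

/-! ### Isotopy classes in space and the disjoint union -/

/-- Euclidean space `ℝ³`; only its topology matters below. In pictures, the first two coordinates
are those of the plane of the diagram and the third one points towards the viewer. -/
abbrev Space : Type := ℝ × ℝ × ℝ

/-- An ambient isotopy of space, with compact support. -/
structure AmbientIsotopy where
  toHomeo : unitInterval → Space ≃ₜ Space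
  continuous' : Continuous fun q : unitInterval × Space => toHomeo q.1 q.2
  at_zero : ∀ p, toHomeo 0 p = p
  compactSupport : ∃ K : Set Space, IsCompact K ∧ ∀ t, ∀ p ∉ K, toHomeo t p = p

/-- Two subsets of space are isotopic if an ambient isotopy carries one to the other. -/
def Isotopic (A B : Set Space) : Prop :=
  ∃ H : AmbientIsotopy, H.toHomeo 1 '' A = B

namespace AmbientIsotopy

theorem continuous_symm (H : AmbientIsotopy) :
    Continuous fun q : unitInterval × Space => (H.toHomeo q.1).symm q.2 := by
  obtain ⟨K, hK, hs⟩ := H.compactSupport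
  let e : unitInterval × Space ≃ unitInterval × Space :=
    { toFun := fun q => (q.1, H.toHomeo q.1 q.2)
      invFun := fun q => (q.1, (H.toHomeo q.1).symm q.2)
      left_inv := fun q => by simp
      right_inv := fun q => by simp }
  have hc : Continuous e := continuous_fst.prodMk H.continuous'
  have hp : IsProperMap e := by
    refine isProperMap_iff_isCompact_preimage.2 ⟨hc, fun C hC => ?_⟩
    refine (hC.union (isCompact_univ.prod hK)).of_isClosed_subset (hC.isClosed.preimage hc) ?_
    rintro ⟨t, p⟩ h
    by_cases hp : p ∈ K
    · exact Or.inr ⟨trivial, hp⟩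
    · have h' : (t, H.toHomeo t p) ∈ C := h
      rw [hs t p hp] at h'
      exact Or.inl h'
  have hi : Continuous e.symm := by
    refine continuous_iff_isClosed.2 fun C hC => ?_
    rw [← e.image_eq_preimage_symm]
    exact hp.isClosedMap C hC
  exact continuous_snd.comp hi

/-- The inverse isotopy. -/
def symm (H : AmbientIsotopy) : AmbientIsotopy where
  toHomeo t := (H.toHomeo t).symm
  continuous' := H.continuous_symm
  at_zero p := by rw [Homeomorph.symm_apply_eq, H.at_zero]
  compactSupport := by
    obtain ⟨K, hK, hs⟩ := H.compactSupport
    exact ⟨K, hK, fun t p hp => by rw [Homeomorph.symm_apply_eq, hs t p hp]⟩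

/-- An ambient isotopy carried over to the image of an open embedding `E`, and extended by the
identity. -/
noncomputable def extendFun (H : AmbientIsotopy) (E : Space → Space) (t : unitInterval) :
    Space → Space :=
  Function.extend E (E ∘ H.toHomeo t) id

theorem extendFun_apply (H : AmbientIsotopy) {E : Space → Space}
    (hE : Topology.IsOpenEmbedding E) (t : unitInterval) (p : Space) :
    H.extendFun E t (E p) = E (H.toHomeo t p) :=
  hE.injective.extend_apply _ _ _

theorem extendFun_of_notMem (H : AmbientIsotopy) (E : Space → Space) (t : unitInterval)
    {p : Space} (hp : p ∉ Set.range E) : H.extendFun E t p = p :=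
  Function.extend_apply' _ _ _ hp

theorem extendFun_of_notMem_image (H : AmbientIsotopy) {E : Space → Space}
    (hE : Topology.IsOpenEmbedding E) {K : Set Space}
    (hs : ∀ t, ∀ p ∉ K, H.toHomeo t p = p) (t : unitInterval) {p : Space} (hp : p ∉ E '' K) :
    H.extendFun E t p = p := by
  by_cases h : p ∈ Set.range E
  · obtain ⟨q, rfl⟩ := h
    rw [H.extendFun_apply hE, hs t q fun hq => hp ⟨q, hq, rfl⟩]
  · exact H.extendFun_of_notMem E t h

theorem extendFun_symm (H : AmbientIsotopy) {E : Space → Space}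
    (hE : Topology.IsOpenEmbedding E) (t : unitInterval) (p : Space) :
    H.symm.extendFun E t (H.extendFun E t p) = p := by
  by_cases h : p ∈ Set.range E
  · obtain ⟨q, rfl⟩ := h
    rw [H.extendFun_apply hE, H.symm.extendFun_apply hE]
    exact congrArg E ((H.toHomeo t).symm_apply_apply q)
  · rw [H.extendFun_of_notMem E t h, H.symm.extendFun_of_notMem E t h]

theorem continuous_extendFun (H : AmbientIsotopy) {E : Space → Space}
    (hE : Topology.IsOpenEmbedding E) :
    Continuous fun q : unitInterval × Space => H.extendFun E q.1 q.2 := by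
  obtain ⟨K, hK, hs⟩ := H.compactSupport
  refine continuous_iff_continuousAt.2 ?_
  rintro ⟨t, p⟩
  by_cases h : p ∈ Set.range E
  · obtain ⟨q, rfl⟩ := h
    have hE' : Topology.IsOpenEmbedding (Prod.map (id : unitInterval → unitInterval) E) :=
      Topology.IsOpenEmbedding.id.prodMap hE
    refine (hE'.continuousAt_iff (x := (t, q))).1 (Continuous.continuousAt ?_)
    refine (hE.continuous.comp H.continuous').congr ?_
    rintro ⟨u, r⟩
    exact (H.extendFun_apply hE u r).symm
  · have hc : IsClosed (E '' K) := (hK.image hE.continuous).isClosed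
    have hp : p ∉ E '' K := fun hp => h (Set.image_subset_range E K hp)
    have hn : (Prod.snd : unitInterval × Space → Space) =ᶠ[nhds (t, p)]
        fun q : unitInterval × Space => H.extendFun E q.1 q.2 := by
      filter_upwards [(hc.isOpen_compl.preimage continuous_snd).mem_nhds hp] with q hq
      exact (H.extendFun_of_notMem_image hE hs q.1 hq).symm
    exact continuous_snd.continuousAt.congr hn

noncomputable def extend (H : AmbientIsotopy) {E : Space → Space}
    (hE : Topology.IsOpenEmbedding E) : AmbientIsotopy where
  toHomeo t :=
    { toFun := H.extendFun E t
      invFun := H.symm.extendFun E t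
      left_inv := H.extendFun_symm hE t
      right_inv := H.symm.extendFun_symm hE t
      continuous_toFun := (H.continuous_extendFun hE).comp (Continuous.prodMk_right t)
      continuous_invFun := (H.symm.continuous_extendFun hE).comp (Continuous.prodMk_right t) }
  continuous' := H.continuous_extendFun hE
  at_zero p := by
    change H.extendFun E 0 p = p
    by_cases h : p ∈ Set.range E
    · obtain ⟨q, rfl⟩ := h
      rw [H.extendFun_apply hE, H.at_zero]
    · exact H.extendFun_of_notMem E 0 h
  compactSupport := by
    obtain ⟨K, hK, hs⟩ := H.compactSupport
    exact ⟨E '' K, hK.image hE.continuous, fun t p hp => H.extendFun_of_notMem_image hE hs t hp⟩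

end AmbientIsotopy

namespace Isotopic

theorem refl (A : Set Space) : Isotopic A A :=
  ⟨{ toHomeo := fun _ => Homeomorph.refl _
     continuous' := continuous_snd
     at_zero := fun _ => rfl
     compactSupport := ⟨∅, isCompact_empty, fun _ _ _ => rfl⟩ }, Set.image_id A⟩

theorem symm {A B : Set Space} : Isotopic A B → Isotopic B A := by
  rintro ⟨H, rfl⟩
  refine ⟨H.symm, ?_⟩
  change (H.toHomeo 1).symm '' (H.toHomeo 1 '' A) = A
  rw [← Set.image_comp]
  simp

theorem trans {A B C : Set Space} : Isotopic A B → Isotopic B C → Isotopic A C := by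
  rintro ⟨H, rfl⟩ ⟨G, rfl⟩
  refine ⟨{ toHomeo := fun t => (H.toHomeo t).trans (G.toHomeo t)
            continuous' := G.continuous'.comp (continuous_fst.prodMk H.continuous')
            at_zero := fun p => by simp [H.at_zero, G.at_zero]
            compactSupport := ?_ }, ?_⟩
  · obtain ⟨K, hK, hs⟩ := H.compactSupport
    obtain ⟨L, hL, hs'⟩ := G.compactSupport
    refine ⟨K ∪ L, hK.union hL, fun t p hp => ?_⟩
    have h1 : p ∉ K := fun h => hp (Or.inl h)
    have h2 : p ∉ L := fun h => hp (Or.inr h)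
    simp [hs t p h1, hs' t p h2]
  · rw [← Set.image_comp]
    rfl

theorem union_right {A B C : Set Space} {E : Space → Space} (hE : Topology.IsOpenEmbedding E)
    (hC : Disjoint C (Set.range E)) : Isotopic A B → Isotopic (E '' A ∪ C) (E '' B ∪ C) := by
  rintro ⟨H, rfl⟩
  refine ⟨H.extend hE, ?_⟩
  rw [Set.image_union]
  congr 1
  · rw [← Set.image_comp, ← Set.image_comp]
    exact Set.image_congr fun p _ => H.extendFun_apply hE 1 p
  · refine (Set.image_congr fun p hp => ?_).trans (Set.image_id C)
    exact H.extendFun_of_notMem E 1 (Set.disjoint_left.1 hC hp)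

end Isotopic

instance isotopySetoid : Setoid (Set Space) where
  r := Isotopic
  iseqv := ⟨Isotopic.refl, Isotopic.symm, Isotopic.trans⟩

/-- Isotopy classes of subsets of space, among them the isotopy classes of (unoriented) links. -/
def IsotopyClass : Type := Quotient isotopySetoid

/-- An orientation preserving homeomorphism of space onto the half-space `x < 0`. -/
noncomputable def intoLeft (p : Space) : Space := (-Real.exp (-p.1), p.2)

/-- An orientation preserving homeomorphism of space onto the half-space `x > 0`. -/
noncomputable def intoRight (p : Space) : Space := (Real.exp p.1, p.2)

theorem isOpenEmbedding_intoRight : Topology.IsOpenEmbedding intoRight :=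
  Real.isOpenEmbedding_exp.prodMap Topology.IsOpenEmbedding.id

theorem isOpenEmbedding_intoLeft : Topology.IsOpenEmbedding intoLeft :=
  (((Homeomorph.neg ℝ).isOpenEmbedding.comp Real.isOpenEmbedding_exp).comp
    (Homeomorph.neg ℝ).isOpenEmbedding).prodMap Topology.IsOpenEmbedding.id

theorem disjoint_intoRight (A : Set Space) :
    Disjoint (intoRight '' A) (Set.range intoLeft) := by
  rw [Set.disjoint_left]
  rintro _ ⟨p, -, rfl⟩ ⟨q, h⟩
  have h1 : -Real.exp (-q.1) = Real.exp p.1 := congrArg Prod.fst h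
  have h2 := Real.exp_pos (-q.1)
  have h3 := Real.exp_pos p.1
  linarith

theorem disjoint_intoLeft (A : Set Space) :
    Disjoint (intoLeft '' A) (Set.range intoRight) := by
  rw [Set.disjoint_left]
  rintro _ ⟨p, -, rfl⟩ ⟨q, h⟩
  have h1 : Real.exp q.1 = -Real.exp (-p.1) := congrArg Prod.fst h
  have h2 := Real.exp_pos q.1
  have h3 := Real.exp_pos (-p.1)
  linarith

/-- The disjoint (split) union of isotopy classes: representatives of the two classes are placed
on different sides of a plane. -/
noncomputable def IsotopyClass.disjointUnion : IsotopyClass → IsotopyClass → IsotopyClass :=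
  Quotient.map₂ (fun A B => intoLeft '' A ∪ intoRight '' B) (by
    intro A A' hA B B' hB
    have h1 : Isotopic (intoLeft '' A ∪ intoRight '' B) (intoLeft '' A' ∪ intoRight '' B) :=
      Isotopic.union_right isOpenEmbedding_intoLeft (disjoint_intoRight B) hA
    have h2 : Isotopic (intoRight '' B ∪ intoLeft '' A') (intoRight '' B' ∪ intoLeft '' A') :=
      Isotopic.union_right isOpenEmbedding_intoRight (disjoint_intoLeft A') hB
    rw [Set.union_comm, Set.union_comm (intoRight '' B')] at h2
    exact h1.trans h2)

/-! ### Jones' algorithm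

The link is drawn with vertical strands, which lie in the plane `z = 0`, and horizontal strands,
which run in front of this plane or behind it. The `k`-th leaf lies on the line `y = 0` at `x = k`.
The upper tree is drawn above this line and the lower tree, upside down, below it. A vertex of a
tree becomes a crossing: its edges to the left and to the right child form the horizontal strand
together with its two ends, its edges to the parent and to the middle child the vertical one. -/

/-- The rule that turns a vertex into a crossing: the strand from the left to the right child
passes over, or under, the strand from the parent to the middle child. The same strand passes over
in the upper tree and in the (reflected) lower tree. The two rules yield mirror images of each
other. -/
inductive CrossingRule : Type
  | horizontalOver : CrossingRule
  | horizontalUnder : CrossingRule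

/-- The level `z` of the horizontal strands. -/
def CrossingRule.level : CrossingRule → ℝ
  | horizontalOver => 1
  | horizontalUnder => -1

/-- The vertical segment above the point `x` from `y = a` to `y = b`. -/
def column (x a b : ℝ) : Set Space :=
  {p | p.1 = x ∧ p.2.1 ∈ Set.Icc a b ∧ p.2.2 = 0}

/-- The horizontal segment on the line of height `y` from `x = a` to `x = b` on the level of the
crossing rule, together with the two segments that join its ends to the plane `z = 0`. -/
def bridge (c : CrossingRule) (y a b : ℝ) : Set Space :=
  {p | p.2.1 = y ∧ ((p.1 ∈ Set.Icc a b ∧ p.2.2 = c.level) ∨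
    ((p.1 = a ∨ p.1 = b) ∧ p.2.2 ∈ Set.uIcc 0 c.level))}

namespace TernaryTree

def height : TernaryTree → ℕ
  | leaf => 0
  | node l m r => max l.height (max m.height r.height) + 1

/-- The position of the root: a vertex is drawn above its middle child. -/
def rootColumn : TernaryTree → ℕ
  | leaf => 0
  | node l m _ => l.numLeaves + m.rootColumn

/-- The drawing of a tree above the line `y = 0` with vertices replaced by crossings. The first
leaf lies at `x = k`, the edge from the root upwards ends at height `y`, and every vertex lies at
the height of its subtree. -/
def draw (c : CrossingRule) : TernaryTree → ℕ → ℕ → Set Space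
  | leaf, k, y => column k 0 y
  | node l m r, k, y =>
      l.draw c k (node l m r).height ∪
      m.draw c (k + l.numLeaves) y ∪
      r.draw c (k + l.numLeaves + m.numLeaves) (node l m r).height ∪
      bridge c (node l m r).height ((k + l.rootColumn : ℕ) : ℝ)
        ((k + l.numLeaves + m.numLeaves + r.rootColumn : ℕ) : ℝ)

/-- The link of a pair of trees: the drawings of the upper tree and of the reflected lower tree,
and an arc to the right of the diagram that joins the two roots. -/
def link (c : CrossingRule) (T S : TernaryTree) : Set Space :=
  T.draw c 0 (T.height + 1) ∪
  (fun p : Space => (p.1, -p.2.1, p.2.2)) '' S.draw c 0 (S.height + 1) ∪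
  (bridge c (T.height + 1) T.rootColumn T.numLeaves ∪
    column T.numLeaves (-(S.height + 1)) (T.height + 1) ∪
    bridge c (-(S.height + 1)) S.rootColumn T.numLeaves)

end TernaryTree

/-- The isotopy class `𝓛(f)` of the link that Jones' algorithm assigns to `f`, through its reduced
pair of trees. -/
noncomputable def F3.jonesLink (c : CrossingRule) (f : F3) : IsotopyClass :=
  Quotient.mk isotopySetoid (f.reducedPair.1.link c f.reducedPair.2)

/-!
For `f ≠ 1`, the reduced pair of `⊔(f, g)` joins those of `g`, of `f` and a single leaf under a new
caret in each tree, by uniqueness of reduced pairs: a reduced pair has the coarsest domain tree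
among all pairs that represent the same element, since a caret of it below a leaf of another pair
would be matched with a caret.

The link of the joined pair is the union of a closed diagram for `g` and one for `f`. Where the two
overlap in the plane of the diagram, the strand of `g` lies on the level of the bridges and the
strand of `f` in the plane. Hence the part of `f` can be pushed off the other part perpendicularly
to the plane and then moved aside, so the link splits. Each part is isotopic to the original link,
from which it differs only by order-preserving changes of the two coordinates of the plane.
-/

theorem third_le_third {i j : Fin 3} (hij : i < j) (s t : unitInterval) :
    third i s ≤ third j t := by
  have h : ((i : ℕ) : ℝ) + 1 ≤ ((j : ℕ) : ℝ) := by exact_mod_cast hij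
  change (((i : ℕ) : ℝ) + s) / 3 ≤ (((j : ℕ) : ℝ) + t) / 3
  linarith [s.2.2, t.2.1]

namespace F3

theorem mul_apply (f g : F3) (t : unitInterval) :
    (f * g).toOrderIso t = g.toOrderIso (f.toOrderIso t) := rfl

theorem ext_apply {f g : F3} (h : ∀ t, f.toOrderIso t = g.toOrderIso t) : f = g :=
  F3.ext (OrderIso.ext (funext h))

theorem phi_place (α : List (Fin 3)) (f : F3) (s : unitInterval) :
    (phi α f).toOrderIso (place α s) = place α (f.toOrderIso s) :=
  phiFun_place α f.toOrderIso s

theorem phi_apply_of_le {α : List (Fin 3)} {t : unitInterval} (h : t ≤ place α 0) (f : F3) :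
    (phi α f).toOrderIso t = t :=
  phiFun_of_le α f.toOrderIso h

theorem phi_apply_of_ge {α : List (Fin 3)} {t : unitInterval} (h : place α 1 ≤ t) (f : F3) :
    (phi α f).toOrderIso t = t :=
  phiFun_of_ge α f.toOrderIso h

theorem phi_mul (α : List (Fin 3)) (f g : F3) : phi α (f * g) = phi α f * phi α g := by
  refine ext_apply fun t => ?_
  by_cases ht : t ∈ Set.range (place α)
  · obtain ⟨s, rfl⟩ := ht
    simp only [mul_apply, phi_place]
  · have fixed (h : F3) : (phi α h).toOrderIso t = t := phiFun_of_notMem α h.toOrderIso ht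
    simp only [mul_apply, fixed]

theorem phi_commute {α β : List (Fin 3)} (hαβ : place α 1 ≤ place β 0) (f g : F3) :
    Commute (phi α f) (phi β g) := by
  refine ext_apply fun t => ?_
  rw [mul_apply, mul_apply]
  rcases le_total t (place β 0) with ht | ht
  · have hft : (phi α f).toOrderIso t ≤ place β 0 := by
      simpa only [phi_apply_of_ge hαβ] using (phi α f).toOrderIso.monotone ht
    rw [phi_apply_of_le ht, phi_apply_of_le hft]
  · have hgt : place β 0 ≤ (phi β g).toOrderIso t := by
      simpa only [phi_apply_of_le le_rfl] using (phi β g).toOrderIso.monotone ht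
    rw [phi_apply_of_ge (hαβ.trans ht), phi_apply_of_ge (hαβ.trans hgt)]

theorem phi_one_commute_phi_zero (f g : F3) : Commute (phi [1] f) (phi [0] g) :=
  (phi_commute (α := [0]) (β := [1])
    (third_le_third (i := 0) (j := 1) Fin.zero_lt_one 1 0) g f).symm

theorem sqcup_mul (f f' g g' : F3) : sqcup (f * f') (g * g') = sqcup f g * sqcup f' g' := by
  simp only [sqcup, phi_mul]
  exact (phi_one_commute_phi_zero f' g).mul_mul_mul_comm _ _

end F3

theorem Represents.numLeaves_eq {f : unitInterval ≃o unitInterval} {T S : TernaryTree}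
    (h : Represents f T S) : T.numLeaves = S.numLeaves := by
  simpa only [TernaryTree.length_leaves] using List.Forall₂.length_eq h

theorem Represents.node {h f₀ f₁ f₂ : unitInterval ≃o unitInterval}
    {T₀ T₁ T₂ S₀ S₁ S₂ : TernaryTree}
    (h₀ : ∀ s, h (third 0 s) = third 0 (f₀ s)) (h₁ : ∀ s, h (third 1 s) = third 1 (f₁ s))
    (h₂ : ∀ s, h (third 2 s) = third 2 (f₂ s))
    (hf₀ : Represents f₀ T₀ S₀) (hf₁ : Represents f₁ T₁ S₁) (hf₂ : Represents f₂ T₂ S₂) :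
    Represents h (.node T₀ T₁ T₂) (.node S₀ S₁ S₂) := by
  have cons {i : Fin 3} {f : unitInterval ≃o unitInterval} {T S : TernaryTree}
      (hi : ∀ s, h (third i s) = third i (f s)) (hf : Represents f T S) :
      List.Forall₂ (fun α β => ∀ s, h (place α s) = place β s)
        (T.leaves.map (List.cons i)) (S.leaves.map (List.cons i)) := by
    rw [List.forall₂_map_left_iff, List.forall₂_map_right_iff]
    exact List.Forall₂.imp (fun α β hαβ s => by simp only [place, hi, hαβ]) hf
  exact List.rel_append (List.rel_append (cons h₀ hf₀) (cons h₁ hf₁)) (cons h₂ hf₂)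

namespace F3

theorem represents_sqcup {f g : F3} {T S T' S' : TernaryTree}
    (hf : Represents f.toOrderIso T S) (hg : Represents g.toOrderIso T' S') :
    Represents (sqcup f g).toOrderIso (.node T' T .leaf) (.node S' S .leaf) := by
  have self (i : Fin 3) (f : F3) (s : unitInterval) :
      (phi [i] f).toOrderIso (third i s) = third i (f.toOrderIso s) := phi_place [i] f s
  have below {i j : Fin 3} (h : i < j) (f : F3) (s : unitInterval) :
      (phi [i] f).toOrderIso (third j s) = third j s := phi_apply_of_ge (third_le_third h 1 s) f
  have above {i j : Fin 3} (h : j < i) (f : F3) (s : unitInterval) :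
      (phi [i] f).toOrderIso (third j s) = third j s := phi_apply_of_le (third_le_third h s 0) f
  refine Represents.node (fun s => ?_) (fun s => ?_) (fun s => ?_) hg hf (represents_refl .leaf)
  · rw [sqcup, mul_apply, above (by decide), self]
  · rw [sqcup, mul_apply, self, below (by decide)]
  · rw [sqcup, mul_apply, below (by decide), below (by decide), OrderIso.refl_apply]

end F3

/-! ### Uniqueness of reduced pairs -/

theorem eq_of_third_eq_third {i j : Fin 3} {s t : unitInterval} (hs : s ∈ Set.Ioo 0 1)
    (ht : t ∈ Set.Ioo 0 1) (h : third i s = third j t) : i = j := by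
  have not_lt {i j : Fin 3} {s t : unitInterval} (hs : s < 1) (ht : 0 < t)
      (h : third i s = third j t) : ¬ i < j := fun hij =>
    ((third_strictMono i hs).trans_le
      ((third_le_third hij 1 0).trans (third_strictMono j ht).le)).ne h
  exact le_antisymm (le_of_not_gt (not_lt ht.2 hs.1 h.symm)) (le_of_not_gt (not_lt hs.2 ht.1 h))

theorem place_cons_ne_id (i : Fin 3) (α : List (Fin 3)) : place (i :: α) ≠ id := by
  intro h
  have h0 : ((i : ℝ) + place α 0) / 3 = 0 := congrArg Subtype.val (congrFun h 0)
  have h1 : ((i : ℝ) + place α 1) / 3 = 1 := congrArg Subtype.val (congrFun h 1)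
  linarith [(place α 0).2.1, (place α 1).2.2]

theorem place_injective : Function.Injective place := by
  intro α
  induction α with
  | nil =>
    rintro (_ | ⟨j, β⟩) h
    · rfl
    · exact absurd h.symm (place_cons_ne_id j β)
  | cons i α ih =>
    rintro (_ | ⟨j, β⟩) h
    · exact absurd h (place_cons_ne_id i α)
    · obtain ⟨m, hm⟩ := exists_between (zero_lt_one (α := unitInterval))
      have interior (γ : List (Fin 3)) : place γ m ∈ Set.Ioo 0 1 :=
        ⟨unitInterval.nonneg'.trans_lt (place_strictMono γ hm.1),
          (place_strictMono γ hm.2).trans_le unitInterval.le_one'⟩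
      obtain rfl : i = j := eq_of_third_eq_third (interior α) (interior β) (congrFun h m)
      rw [ih (funext fun s => (third_strictMono i).injective (congrFun h s))]

namespace TernaryTree

theorem numLeaves_pos (T : TernaryTree) : 0 < T.numLeaves := by
  induction T with
  | leaf => exact Nat.one_pos
  | node l m r hl hm hr => simp only [numLeaves]; omega

theorem numLeaves_eq_one {T : TernaryTree} : T.numLeaves = 1 ↔ T = leaf := by
  cases T with
  | leaf => exact ⟨fun _ => rfl, fun _ => rfl⟩
  | node l m r =>
    have hl := l.numLeaves_pos
    have hm := m.numLeaves_pos
    simp only [numLeaves, reduceCtorEq, iff_false]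
    omega

theorem nil_mem_leaves {T : TernaryTree} : [] ∈ T.leaves ↔ T = leaf := by
  cases T <;> simp [leaves]

theorem cons_mem_leaves_node {l m r : TernaryTree} {i : Fin 3} {α : List (Fin 3)} :
    i :: α ∈ (node l m r).leaves ↔ α ∈ (![l, m, r] i).leaves := by
  fin_cases i <;> simp [leaves]

theorem nodup_leaves (T : TernaryTree) : T.leaves.Nodup := by
  induction T with
  | leaf => exact List.nodup_singleton _
  | node l m r hl hm hr =>
    have disjoint {i j : Fin 3} (hij : i ≠ j) (A B : List (List (Fin 3))) :
        (A.map (List.cons i)).Disjoint (B.map (List.cons j)) := by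
      intro x hA hB
      obtain ⟨α, -, rfl⟩ := List.mem_map.1 hA
      obtain ⟨β, -, h⟩ := List.mem_map.1 hB
      exact hij (List.cons_eq_cons.1 h).1.symm
    refine ((hl.map List.cons_injective).append (hm.map List.cons_injective)
      (disjoint (by decide) _ _)).append (hr.map List.cons_injective) ?_
    rw [List.disjoint_append_left]
    exact ⟨disjoint (by decide) _ _, disjoint (by decide) _ _⟩

theorem ext_mem_leaves {T S : TernaryTree} (h : ∀ α, α ∈ T.leaves ↔ α ∈ S.leaves) : T = S := by
  induction T generalizing S with
  | leaf => exact (nil_mem_leaves.1 ((h []).1 (nil_mem_leaves.2 rfl))).symm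
  | node l m r hl hm hr =>
    cases S with
    | leaf => exact nil_mem_leaves.1 ((h []).2 (nil_mem_leaves.2 rfl))
    | node l' m' r' =>
      have child (i : Fin 3) (α : List (Fin 3)) :
          α ∈ (![l, m, r] i).leaves ↔ α ∈ (![l', m', r'] i).leaves := by
        rw [← cons_mem_leaves_node, ← cons_mem_leaves_node, h]
      obtain rfl : l = l' := hl (child 0)
      obtain rfl : m = m' := hm (child 1)
      obtain rfl : r = r' := hr (child 2)
      rfl

theorem leaves_injective : Function.Injective leaves := fun _ _ h =>
  ext_mem_leaves fun _ => by rw [h]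

/-- `T.IsPruning S`: the tree `T` arises from `S` by cutting off subtrees, so that the subdivision
of `T` is coarser than that of `S`. -/
inductive IsPruning : TernaryTree → TernaryTree → Prop
  | leaf (S : TernaryTree) : IsPruning leaf S
  | node {l m r l' m' r' : TernaryTree} :
      IsPruning l l' → IsPruning m m' → IsPruning r r' → IsPruning (node l m r) (node l' m' r')

theorem IsPruning.antisymm {T S : TernaryTree} (h : T.IsPruning S) (h' : S.IsPruning T) :
    T = S := by
  induction h with
  | leaf S => cases h'; rfl
  | node _ _ _ hl hm hr =>
    cases h' with
    | node h₁ h₂ h₃ => rw [hl h₁, hm h₂, hr h₃]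

theorem exists_caret {T : TernaryTree} (h : T ≠ leaf) :
    ∃ δ : List (Fin 3), ∀ i, δ ++ [i] ∈ T.leaves := by
  induction T with
  | leaf => exact absurd rfl h
  | node l m r hl hm hr =>
    have below (j : Fin 3) (hj : ∃ δ : List (Fin 3), ∀ i, δ ++ [i] ∈ (![l, m, r] j).leaves) :
        ∃ δ : List (Fin 3), ∀ i, δ ++ [i] ∈ (node l m r).leaves :=
      hj.imp' (List.cons j) fun δ hδ i => cons_mem_leaves_node.2 (hδ i)
    by_cases h₀ : l = leaf
    · by_cases h₁ : m = leaf
      · by_cases h₂ : r = leaf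
        · subst h₀ h₁ h₂
          exact ⟨[], by decide⟩
        · exact below 2 (hr h₂)
      · exact below 1 (hm h₁)
    · exact below 0 (hl h₀)

theorem exists_caret_of_not_isPruning {T S : TernaryTree} (h : ¬ T.IsPruning S) :
    ∃ α ∈ S.leaves, ∃ δ : List (Fin 3), ∀ i, α ++ δ ++ [i] ∈ T.leaves := by
  induction T generalizing S with
  | leaf => exact absurd (IsPruning.leaf S) h
  | node l m r hl hm hr =>
    cases S with
    | leaf => exact ⟨[], List.mem_singleton_self _, exists_caret (by simp)⟩
    | node l' m' r' =>
      have below (j : Fin 3) (hj : ∃ α ∈ (![l', m', r'] j).leaves, ∃ δ : List (Fin 3),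
          ∀ i, α ++ δ ++ [i] ∈ (![l, m, r] j).leaves) :
          ∃ α ∈ (node l' m' r').leaves, ∃ δ : List (Fin 3),
            ∀ i, α ++ δ ++ [i] ∈ (node l m r).leaves := by
        obtain ⟨α, hα, δ, hδ⟩ := hj
        exact ⟨j :: α, cons_mem_leaves_node.2 hα, δ, fun i => cons_mem_leaves_node.2 (hδ i)⟩
      by_cases h₀ : l.IsPruning l'
      · by_cases h₁ : m.IsPruning m'
        · exact below 2 (hr fun h₂ => h (.node h₀ h₁ h₂))
        · exact below 1 (hm h₁)
      · exact below 0 (hl h₀)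

theorem getElem?_leaves_left {l m r : TernaryTree} {k : ℕ} {α : List (Fin 3)}
    (h : l.leaves[k]? = some α) : (node l m r).leaves[k]? = some (0 :: α) := by
  have hk := (List.getElem?_eq_some_iff.1 h).1
  rw [leaves, List.append_assoc, List.getElem?_append_left (by simpa only [List.length_map])]
  simp only [List.getElem?_map, h, Option.map_some]

theorem getElem?_leaves_mid {l m r : TernaryTree} {k : ℕ} {α : List (Fin 3)}
    (h : m.leaves[k]? = some α) :
    (node l m r).leaves[l.numLeaves + k]? = some (1 :: α) := by
  have hk := (List.getElem?_eq_some_iff.1 h).1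
  rw [leaves, List.append_assoc, List.getElem?_append_right (by simp [length_leaves]),
    List.getElem?_append_left (by simpa [length_leaves] using hk)]
  simp [h, length_leaves]

theorem getElem?_leaves_right {l m r : TernaryTree} {k : ℕ} {α : List (Fin 3)}
    (h : r.leaves[k]? = some α) :
    (node l m r).leaves[l.numLeaves + m.numLeaves + k]? = some (2 :: α) := by
  rw [leaves, List.getElem?_append_right (by simp [length_leaves])]
  simp [h, length_leaves]

theorem exists_addCaret {T : TernaryTree} {δ : List (Fin 3)} (h : ∀ i, δ ++ [i] ∈ T.leaves) :
    ∃ k T', AddCaret k T' T ∧ T.leaves[k]? = some (δ ++ [0]) := by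
  induction T generalizing δ with
  | leaf => simpa [leaves] using h 0
  | node l m r hl hm hr =>
    cases δ with
    | nil =>
      have child (i : Fin 3) : ![l, m, r] i = leaf :=
        nil_mem_leaves.1 (cons_mem_leaves_node.1 (h i))
      obtain rfl : l = leaf := child 0
      obtain rfl : m = leaf := child 1
      obtain rfl : r = leaf := child 2
      exact ⟨0, leaf, AddCaret.here, rfl⟩
    | cons j δ =>
      have hj (i : Fin 3) : δ ++ [i] ∈ (![l, m, r] j).leaves := cons_mem_leaves_node.1 (h i)
      match j with
      | 0 =>
        obtain ⟨k, l', hl', hk⟩ := hl hj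
        exact ⟨k, _, .left k l' l m r hl', getElem?_leaves_left hk⟩
      | 1 =>
        obtain ⟨k, m', hm', hk⟩ := hm hj
        exact ⟨_, _, .mid k l m' m r hm', getElem?_leaves_mid hk⟩
      | 2 =>
        obtain ⟨k, r', hr', hk⟩ := hr hj
        exact ⟨_, _, .right k l m r' r hr', getElem?_leaves_right hk⟩

theorem AddCaret.add_two_lt {i : ℕ} {T T' : TernaryTree} (h : AddCaret i T T') :
    i + 2 < T'.numLeaves := by
  induction h with
  | here => decide
  | left _ _ _ _ _ _ ih => simp only [numLeaves]; omega
  | mid _ _ _ _ _ _ ih => simp only [numLeaves]; omega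
  | right _ _ _ _ _ _ ih => simp only [numLeaves]; omega

theorem AddCaret.cases_node {i : ℕ} {T l m r : TernaryTree} (h : AddCaret i T (node l m r)) :
    (l = leaf ∧ m = leaf ∧ r = leaf) ∨ (∃ l', AddCaret i l' l) ∨
      (∃ j m', i = l.numLeaves + j ∧ AddCaret j m' m) ∨
      ∃ j r', i = l.numLeaves + m.numLeaves + j ∧ AddCaret j r' r := by
  cases h with
  | here => exact .inl ⟨rfl, rfl, rfl⟩
  | left _ l' _ _ _ h => exact .inr (.inl ⟨l', h⟩)
  | mid j _ m' _ _ h => exact .inr (.inr (.inl ⟨j, m', rfl, h⟩))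
  | right j _ _ r' _ h => exact .inr (.inr (.inr ⟨j, r', rfl, h⟩))

theorem Reduced.node {l m r l' m' r' : TernaryTree} (hl : Reduced l l') (hm : Reduced m m')
    (hr : Reduced r r') (nl : l.numLeaves = l'.numLeaves) (nm : m.numLeaves = m'.numLeaves)
    (nr : r.numLeaves = r'.numLeaves) (hne : ¬ (l = leaf ∧ m = leaf ∧ r = leaf)) :
    Reduced (node l m r) (node l' m' r') := by
  have hne' : ¬ (l' = leaf ∧ m' = leaf ∧ r' = leaf) := by
    simpa only [← numLeaves_eq_one, nl, nm, nr] using hne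
  rintro ⟨i, U, V, hU, hV⟩
  rcases hU.cases_node with h | ⟨l₁, h⟩ | ⟨j, m₁, hj, h⟩ | ⟨j, r₁, hj, h⟩
  · exact hne h
  all_goals
    rcases hV.cases_node with h' | ⟨l₂, h'⟩ | ⟨k, m₂, hk, h'⟩ | ⟨k, r₂, hk, h'⟩
    · exact hne' h'
    all_goals
      have lt := h.add_two_lt
      have lt' := h'.add_two_lt
  · exact hl ⟨i, l₁, l₂, h, h'⟩
  · omega
  · omega
  · omega
  · obtain rfl : j = k := by omega
    exact hm ⟨j, m₁, m₂, h, h'⟩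
  · omega
  · omega
  · omega
  · obtain rfl : j = k := by omega
    exact hr ⟨j, r₁, r₂, h, h'⟩

theorem reduced_leaf (S : TernaryTree) : Reduced leaf S := by
  rintro ⟨_, _, _, h, _⟩
  cases h

end TernaryTree

theorem Represents.eq_right {f : unitInterval ≃o unitInterval} {T S S' : TernaryTree}
    (h : Represents f T S) (h' : Represents f T S') : S = S' := by
  have unique : Relator.RightUnique fun α β => ∀ s, f (place α s) = place β s :=
    fun _ _ _ hβ hγ => place_injective (funext fun s => (hβ s).symm.trans (hγ s))
  exact TernaryTree.leaves_injective (unique.forall₂ h h')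

theorem Represents.getElem? {f : unitInterval ≃o unitInterval} {T S : TernaryTree}
    (h : Represents f T S) {k : ℕ} {α β : List (Fin 3)} (hα : T.leaves[k]? = some α)
    (hf : ∀ s, f (place α s) = place β s) : S.leaves[k]? = some β := by
  obtain ⟨hk, rfl⟩ := List.getElem?_eq_some_iff.1 hα
  have hk' : k < S.leaves.length := by rwa [← List.Forall₂.length_eq h]
  have hS := (List.forall₂_iff_get.1 h).2 k hk hk'
  exact List.getElem?_eq_some_iff.2 ⟨hk', place_injective (funext fun s =>
    (hS s).symm.trans (hf s))⟩

theorem Represents.exists_address {f : unitInterval ≃o unitInterval} {T S : TernaryTree}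
    (h : Represents f T S) {α : List (Fin 3)} (hα : α ∈ T.leaves) :
    ∃ β, ∀ s, f (place α s) = place β s := by
  obtain ⟨k, hk, rfl⟩ := List.getElem_of_mem hα
  exact ⟨_, (List.forall₂_iff_get.1 h).2 k hk (by rwa [← List.Forall₂.length_eq h])⟩

theorem Represents.isPruning_of_reduced {f : unitInterval ≃o unitInterval}
    {T S T' S' : TernaryTree} (h : Represents f T S) (hr : T.Reduced S)
    (h' : Represents f T' S') : T.IsPruning T' := by
  by_contra hT
  obtain ⟨α, hα, δ, hδ⟩ := TernaryTree.exists_caret_of_not_isPruning hT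
  obtain ⟨β, hβ⟩ := h'.exists_address hα
  have hf (i : Fin 3) (s : unitInterval) :
      f (place (α ++ δ ++ [i]) s) = place (β ++ δ ++ [i]) s := by
    simp only [List.append_assoc, place_append α, place_append β, hβ]
  have hβδ (i : Fin 3) : β ++ δ ++ [i] ∈ S.leaves := by
    obtain ⟨k, hk⟩ := List.mem_iff_getElem?.1 (hδ i)
    exact List.mem_iff_getElem?.2 ⟨k, h.getElem? hk (hf i)⟩
  obtain ⟨k, U, hU, hk⟩ := TernaryTree.exists_addCaret hδ
  obtain ⟨k', V, hV, hk'⟩ := TernaryTree.exists_addCaret hβδ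
  have image_at_k := h.getElem? hk (hf 0)
  obtain rfl : k = k' := (List.getElem?_inj (List.getElem?_eq_some_iff.1 image_at_k).1
    S.nodup_leaves).1 (image_at_k.trans hk'.symm)
  exact hr ⟨k, U, V, hU, hV⟩

theorem Represents.unique {f : unitInterval ≃o unitInterval} {T S T' S' : TernaryTree}
    (h : Represents f T S) (hr : T.Reduced S) (h' : Represents f T' S') (hr' : T'.Reduced S') :
    T = T' ∧ S = S' := by
  obtain rfl := (h.isPruning_of_reduced hr h').antisymm (h'.isPruning_of_reduced hr' h)
  exact ⟨rfl, h.eq_right h'⟩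

namespace F3

theorem eq_one_of_represents_leaf {f : F3} {S : TernaryTree}
    (h : Represents f.toOrderIso .leaf S) : f = 1 := by
  obtain rfl : S = .leaf := TernaryTree.numLeaves_eq_one.1 h.numLeaves_eq.symm
  exact ext_apply (List.forall₂_cons.1 h).1

theorem reducedPair_spec (f : F3) :
    Represents f.toOrderIso f.reducedPair.1 f.reducedPair.2 ∧
      f.reducedPair.1.Reduced f.reducedPair.2 :=
  Classical.choose_spec f.exists_reducedPair

theorem reducedPair_sqcup {f : F3} (g : F3) (hf : f ≠ 1) :
    (sqcup f g).reducedPair = (.node g.reducedPair.1 f.reducedPair.1 .leaf,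
      .node g.reducedPair.2 f.reducedPair.2 .leaf) := by
  obtain ⟨rep_f, red_f⟩ := f.reducedPair_spec
  obtain ⟨rep_g, red_g⟩ := g.reducedPair_spec
  obtain ⟨rep, red⟩ := (sqcup f g).reducedPair_spec
  have hne : f.reducedPair.1 ≠ .leaf := fun h => hf (eq_one_of_represents_leaf (h ▸ rep_f))
  have red' := red_g.node red_f (TernaryTree.reduced_leaf .leaf) rep_g.numLeaves_eq
    rep_f.numLeaves_eq rfl fun h => hne h.2.1
  exact Prod.ext_iff.2 (rep.unique red (represents_sqcup rep_f rep_g) red')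

end F3

/-! ### Isotopies along parallel lines -/

theorem isProperMap_of_eq_self_of_notMem {X : Type*} [TopologicalSpace X] [T2Space X]
    [WeaklyLocallyCompactSpace X] {f : X → X} (hf : Continuous f) {K : Set X} (hK : IsCompact K)
    (h : ∀ x ∉ K, f x = x) : IsProperMap f := by
  refine isProperMap_iff_isCompact_preimage.2 ⟨hf, fun C hC => ?_⟩
  refine (hC.union hK).of_isClosed_subset (hC.isClosed.preimage hf) fun x hx => ?_
  by_cases hxK : x ∈ K
  · exact Or.inr hxK
  · exact Or.inl (h x hxK ▸ hx)

theorem exists_lipschitzWith_hasCompactSupport {E : Type*} [SeminormedAddCommGroup E]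
    [ProperSpace E] {L : NNReal} (hL : 0 < L) {A : Set E} (hA : IsCompact A) (M : ℝ) :
    ∃ β : E → ℝ, LipschitzWith L β ∧ HasCompactSupport β ∧ ∀ p ∈ A, M ≤ β p := by
  obtain ⟨R, hR⟩ := hA.isBounded.exists_norm_le
  have hL' : (0 : ℝ) < L := hL
  refine ⟨fun p => max 0 (M + L * (R - ‖p‖)), LipschitzWith.const_max ?_ 0, ?_,
    fun p hp => le_max_of_le_right ?_⟩
  · refine LipschitzWith.of_le_add_mul L fun p q => ?_
    have h : ‖q‖ - ‖p‖ ≤ dist p q := by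
      rw [dist_comm, dist_eq_norm]
      exact norm_sub_norm_le q p
    linarith [mul_le_mul_of_nonneg_left h hL'.le]
  · refine HasCompactSupport.of_support_subset_isCompact
      (isCompact_closedBall (0 : E) (R + M / L)) fun p hp => ?_
    have h0 : 0 < M + L * (R - ‖p‖) := lt_of_not_ge fun h => hp (max_eq_left h)
    have h1 : ‖p‖ - R < M / L := by rw [lt_div_iff₀ hL']; linarith
    rw [mem_closedBall_zero_iff]
    linarith
  · linarith [mul_nonneg hL'.le (sub_nonneg.2 (hR p hp))]

section Shear

variable {E : Type*} [NormedAddCommGroup E] [NormedSpace ℝ E]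

/-- The map that moves each point `p` along the line through `p` in the direction `e`, by the
weight `w p`. -/
def shear (e : E) (w : E → ℝ) (p : E) : E := p + w p • e

/-- The shear along `e` with weight `w` preserves the order on each line in the direction `e`;
in particular it is injective. -/
def PreservesLineOrder (e : E) (w : E → ℝ) : Prop :=
  ∀ p, StrictMono fun s : ℝ => s + w (p + s • e)

namespace PreservesLineOrder

variable {e : E} {v w : E → ℝ}

theorem of_lipschitzWith {K : NNReal} (hw : LipschitzWith K w) (hK : K * ‖e‖ < 1) :
    PreservesLineOrder e w := by
  intro p s t hst
  have hdist : dist (p + s • e) (p + t • e) = (t - s) * ‖e‖ := by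
    rw [dist_add_left, dist_comm, dist_eq_norm, ← sub_smul, norm_smul, Real.norm_eq_abs,
      abs_of_pos (sub_pos.2 hst)]
  have hle : w (p + s • e) - w (p + t • e) ≤ K * ((t - s) * ‖e‖) :=
    hdist ▸ (le_abs_self _).trans (hw.dist_le_mul _ _)
  have hlt : (t - s) * (K * ‖e‖) < t - s := mul_lt_of_lt_one_right (sub_pos.2 hst) hK
  beta_reduce
  linarith

theorem of_monotone (hw : ∀ p, Monotone fun s : ℝ => w (p + s • e)) : PreservesLineOrder e w :=
  fun p => strictMono_id.add_monotone (hw p)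

theorem sup (hv : PreservesLineOrder e v) (hw : PreservesLineOrder e w) :
    PreservesLineOrder e fun p => max (v p) (w p) := fun p s t hst => by
  simpa only [← max_add_add_left] using max_lt_max (hv p hst) (hw p hst)

theorem inf (hv : PreservesLineOrder e v) (hw : PreservesLineOrder e w) :
    PreservesLineOrder e fun p => min (v p) (w p) := fun p s t hst => by
  simpa only [← min_add_add_left] using min_lt_min (hv p hst) (hw p hst)

theorem const_mul (hw : PreservesLineOrder e w) (t : unitInterval) :
    PreservesLineOrder e fun p => t * w p := by
  intro p a b hab
  have h : a + w (p + a • e) < b + w (p + b • e) := hw p hab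
  have h0 := t.2.1
  have h1 := t.2.2
  change a + t * w (p + a • e) < b + t * w (p + b • e)
  rcases h0.eq_or_lt with ht | ht
  · simpa [← ht] using hab
  · linarith [mul_lt_mul_of_pos_left h ht, mul_le_mul_of_nonneg_left hab.le (sub_nonneg.2 h1)]

theorem shear_injective (hw : PreservesLineOrder e w) : Function.Injective (shear e w) := by
  intro p q hpq
  have hq : p + (w p - w q) • e = q := by
    rw [sub_smul, ← add_sub_assoc]
    exact sub_eq_of_eq_add hpq
  have hs : w p - w q = 0 := (hw p).injective (by simp [hq])
  rwa [hs, zero_smul, add_zero] at hq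

end PreservesLineOrder

theorem continuous_shear {e : E} {w : E → ℝ} (hw : Continuous w) : Continuous (shear e w) :=
  continuous_id.add (hw.smul continuous_const)

theorem shear_surjective {e : E} {w : E → ℝ} (hw : Continuous w) (hs : HasCompactSupport w) :
    Function.Surjective (shear e w) := by
  intro q
  obtain ⟨C, hC⟩ := hs.exists_bound_of_continuous hw
  have hle (p : E) : -C ≤ w p ∧ w p ≤ C := abs_le.1 (hC p)
  have hsurj : Function.Surjective fun s : ℝ => s + w (q + s • e) :=
    Continuous.surjective (by fun_prop)
      (Filter.tendsto_atTop_add_right_of_le _ (-C) Filter.tendsto_id fun _ => (hle _).1)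
      (Filter.tendsto_atBot_add_right_of_ge _ C Filter.tendsto_id fun _ => (hle _).2)
  obtain ⟨s, hs0 : s + w (q + s • e) = 0⟩ := hsurj 0
  refine ⟨q + s • e, ?_⟩
  rw [shear, add_assoc, ← add_smul, hs0, zero_smul, add_zero]

theorem isHomeomorph_shear [ProperSpace E] {e : E} {w : E → ℝ} (hw : Continuous w)
    (hs : HasCompactSupport w) (he : PreservesLineOrder e w) : IsHomeomorph (shear e w) :=
  isHomeomorph_iff_continuous_isClosedMap_bijective.2 ⟨continuous_shear hw,
    (isProperMap_of_eq_self_of_notMem (continuous_shear hw) hs fun p hp => by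
      rw [shear, image_eq_zero_of_notMem_tsupport hp, zero_smul, add_zero]).isClosedMap,
    he.shear_injective, shear_surjective hw hs⟩

theorem PreservesLineOrder.exists_eqOn_hasCompactSupport [ProperSpace E] {e : E} {w : E → ℝ}
    (he : PreservesLineOrder e w) (hw : Continuous w) {A : Set E} (hA : IsCompact A) :
    ∃ v : E → ℝ, PreservesLineOrder e v ∧ Continuous v ∧ HasCompactSupport v ∧ Set.EqOn v w A := by
  obtain ⟨M, hM⟩ := hA.exists_bound_of_continuousOn hw.continuousOn
  let L : NNReal := (‖e‖₊ + 1)⁻¹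
  have hL : (L : ℝ) * ‖e‖ < 1 := by
    change (‖e‖ + 1)⁻¹ * ‖e‖ < 1
    rw [inv_mul_lt_one₀ (by positivity)]
    exact lt_add_one _
  obtain ⟨β, hβ, hβs, hβM⟩ :=
    exists_lipschitzWith_hasCompactSupport (by positivity : 0 < L) hA M
  have hβ' : LipschitzWith L fun p => -β p := hβ.neg
  refine ⟨fun p => max (-β p) (min (w p) (β p)),
    (of_lipschitzWith hβ' hL).sup (he.inf (of_lipschitzWith hβ hL)),
    hβ'.continuous.max (hw.min hβ.continuous), hβs.mono fun p => ?_, fun p hp => ?_⟩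
  · refine mt fun hp => ?_
    simp only [hp, neg_zero, inf_le_right, sup_of_le_left]
  · obtain ⟨h1, h2⟩ := abs_le.1 ((hM p hp).trans (hβM p hp))
    change max (-β p) (min (w p) (β p)) = w p
    rw [min_eq_left h2, max_eq_right h1]

end Shear

theorem isotopic_shear {e : Space} {w : Space → ℝ} (hw : Continuous w) (hs : HasCompactSupport w)
    (he : PreservesLineOrder e w) (A : Set Space) : Isotopic A (shear e w '' A) := by
  have hsupp (t : unitInterval) {p : Space} (hp : p ∉ tsupport w) :
      shear e (fun p => t * w p) p = p := by
    simp [shear, image_eq_zero_of_notMem_tsupport hp]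
  refine ⟨{ toHomeo := fun t => (isHomeomorph_shear (continuous_const.mul hw) hs.mul_left
              (he.const_mul t)).homeomorph
            continuous' := ?_
            at_zero := fun p => ?_
            compactSupport := ⟨tsupport w, hs, fun t p => hsupp t⟩ }, ?_⟩
  · change Continuous fun q : unitInterval × Space => q.2 + ((q.1 : ℝ) * w q.2) • e
    fun_prop
  · simp [shear]
  · refine Set.image_congr fun p _ => ?_
    change p + (((1 : unitInterval) : ℝ) * w p) • e = p + w p • e
    rw [Set.Icc.coe_one, one_mul]

theorem isotopic_shear_of_isCompact {e : Space} {w : Space → ℝ} (hw : Continuous w)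
    (he : PreservesLineOrder e w) {A : Set Space} (hA : IsCompact A) :
    Isotopic A (shear e w '' A) := by
  obtain ⟨v, hve, hv, hvs, hvA⟩ := he.exists_eqOn_hasCompactSupport hw hA
  have himage : shear e v '' A = shear e w '' A :=
    Set.image_congr fun p hp => by rw [shear, shear, hvA hp]
  exact himage ▸ isotopic_shear hv hvs hve A

namespace Isotopic

theorem translate {A : Set Space} (hA : IsCompact A) (v : Space) :
    Isotopic A ((· + v) '' A) := by
  have h := isotopic_shear_of_isCompact (e := v) (w := fun _ => 1) continuous_const
    (.of_monotone fun _ => monotone_const) hA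
  rwa [Set.image_congr fun p _ => show shear v (fun _ => 1) p = p + v by rw [shear, one_smul]] at h

theorem map_fst {A : Set Space} (hA : IsCompact A) {φ : ℝ → ℝ} (hφ : StrictMono φ)
    (hc : Continuous φ) : Isotopic A ((fun p => (φ p.1, p.2)) '' A) := by
  have he : PreservesLineOrder (1, 0, 0) fun p : Space => φ p.1 - p.1 := fun p s t hst => by
    simpa [add_sub_left_comm, ← sub_sub] using hφ (add_lt_add_right hst p.1)
  convert isotopic_shear_of_isCompact (by fun_prop) he hA using 3
  all_goals simp [shear]

theorem map_snd {A : Set Space} (hA : IsCompact A) {φ : ℝ → ℝ} (hφ : StrictMono φ)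
    (hc : Continuous φ) : Isotopic A ((fun p => (p.1, φ p.2.1, p.2.2)) '' A) := by
  have he : PreservesLineOrder (0, 1, 0) fun p : Space => φ p.2.1 - p.2.1 := fun p s t hst => by
    simpa [add_sub_left_comm, ← sub_sub] using hφ (add_lt_add_right hst p.2.1)
  convert isotopic_shear_of_isCompact (by fun_prop) he hA using 3
  all_goals simp [shear, Prod.ext_iff]

end Isotopic

/-! ### Splitting -/

section Sweep

open scoped Pointwise

variable {E : Type*} [NormedAddCommGroup E] [NormedSpace ℝ E]

/-- The set of points that `X` passes through when it is translated by all nonnegative multiples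
of `e`. -/
def sweep (e : E) (X : Set E) : Set E := X + (fun t : ℝ => t • e) '' Set.Ici 0

theorem mem_sweep {e : E} {X : Set E} {p : E} :
    p ∈ sweep e X ↔ ∃ x ∈ X, ∃ t : ℝ, 0 ≤ t ∧ x + t • e = p := by
  simp [sweep, Set.mem_add]

theorem subset_sweep (e : E) (X : Set E) : X ⊆ sweep e X :=
  fun x hx => mem_sweep.2 ⟨x, hx, 0, le_rfl, by simp⟩

theorem add_smul_mem_sweep {e : E} {X : Set E} {p : E} (hp : p ∈ sweep e X) {t : ℝ}
    (ht : 0 ≤ t) : p + t • e ∈ sweep e X := by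
  obtain ⟨x, hx, s, hs, rfl⟩ := mem_sweep.1 hp
  exact mem_sweep.2 ⟨x, hx, s + t, add_nonneg hs ht, by rw [add_smul, add_assoc]⟩

theorem isClosed_sweep (e : E) {X : Set E} (hX : IsCompact X) : IsClosed (sweep e X) :=
  (isClosedMap_smul_left e _ isClosed_Ici).add_left_of_isCompact hX

theorem antitone_infEDist_sweep (e : E) (X : Set E) (p : E) :
    Antitone fun s : ℝ => Metric.infEDist (p + s • e) (sweep e X) := by
  intro s t hst
  refine Metric.le_infEDist.2 fun q hq => ?_
  have hq' := add_smul_mem_sweep hq (sub_nonneg.2 hst)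
  calc Metric.infEDist (p + t • e) (sweep e X)
      ≤ edist (p + t • e) (q + (t - s) • e) := Metric.infEDist_le_edist_of_mem hq'
    _ = edist (p + s • e + (t - s) • e) (q + (t - s) • e) := by
        rw [add_assoc, ← add_smul, add_sub_cancel]
    _ = edist (p + s • e) q := edist_add_right _ _ _

theorem exists_weight_of_disjoint_sweep {e : E} {A B : Set E} (hA : IsCompact A)
    (hB : IsCompact B) (h : Disjoint A (sweep e B)) :
    ∃ w : E → ℝ, Continuous w ∧ PreservesLineOrder e w ∧ Set.EqOn w 0 A ∧ Set.EqOn w 1 B := by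
  obtain ⟨δ, hδ, hdisj⟩ := h.exists_thickenings hA (isClosed_sweep e hB)
  refine ⟨fun p => thickenedIndicator hδ (sweep e B) p,
    NNReal.continuous_coe.comp (thickenedIndicator hδ _).continuous,
    .of_monotone fun p s t hst => ?_, fun a ha => ?_, fun b hb => ?_⟩
  · exact NNReal.coe_le_coe.2
      (thickenedIndicator_mono_infEDist hδ (antitone_infEDist_sweep e B p hst))
  · have ha' : a ∉ Metric.thickening δ (sweep e B) :=
      hdisj.notMem_of_mem_left (Metric.self_subset_thickening hδ A ha)
    exact congrArg NNReal.toReal (thickenedIndicator_zero hδ _ ha')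
  · exact congrArg NNReal.toReal (thickenedIndicator_one hδ _ (subset_sweep e B hb))

end Sweep

theorem Isotopic.union_translate {A B : Set Space} (hA : IsCompact A) (hB : IsCompact B)
    {e : Space} (h : Disjoint A (sweep e B)) : Isotopic (A ∪ B) (A ∪ (· + e) '' B) := by
  obtain ⟨w, hw, he, hwA, hwB⟩ := exists_weight_of_disjoint_sweep hA hB h
  have hshear := isotopic_shear_of_isCompact hw he (hA.union hB)
  have hshearA : shear e w '' A = A :=
    (Set.image_congr fun p hp => by simp [shear, hwA hp]).trans (Set.image_id A)
  have hshearB : shear e w '' B = (· + e) '' B :=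
    Set.image_congr fun p hp => by simp [shear, hwB hp]
  rwa [Set.image_union, hshearA, hshearB] at hshear

theorem isotopic_intoRight {P : Set Space} (hP : IsCompact P) : Isotopic P (intoRight '' P) :=
  Isotopic.map_fst hP Real.exp_strictMono Real.continuous_exp

theorem isotopic_intoLeft {P : Set Space} (hP : IsCompact P) : Isotopic P (intoLeft '' P) :=
  Isotopic.map_fst hP (fun _ _ h => neg_lt_neg (Real.exp_strictMono (neg_lt_neg h)))
    (φ := fun x => -Real.exp (-x)) (by fun_prop)

theorem exists_intoRight_image_eq {A : Set Space} (hA : IsCompact A) (hpos : ∀ p ∈ A, 0 < p.1) :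
    ∃ P, IsCompact P ∧ intoRight '' P = A := by
  have hrange : A ⊆ Set.range intoRight := fun p hp =>
    ⟨(Real.log p.1, p.2), by simp [intoRight, Real.exp_log (hpos p hp)]⟩
  exact ⟨intoRight ⁻¹' A,
    (isOpenEmbedding_intoRight.isInducing.isCompact_preimage_iff hrange).2 hA,
    Set.image_preimage_eq_of_subset hrange⟩

theorem exists_intoLeft_image_eq {A : Set Space} (hA : IsCompact A) (hneg : ∀ p ∈ A, p.1 < 0) :
    ∃ P, IsCompact P ∧ intoLeft '' P = A := by
  have hrange : A ⊆ Set.range intoLeft := fun p hp =>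
    ⟨(-Real.log (-p.1), p.2), by
      rw [intoLeft, neg_neg, Real.exp_log (neg_pos.2 (hneg p hp)), neg_neg]⟩
  exact ⟨intoLeft ⁻¹' A,
    (isOpenEmbedding_intoLeft.isInducing.isCompact_preimage_iff hrange).2 hA,
    Set.image_preimage_eq_of_subset hrange⟩

namespace IsotopyClass

theorem mk_union_of_neg_of_pos {A B : Set Space} (hA : IsCompact A) (hB : IsCompact B)
    (hneg : ∀ p ∈ A, p.1 < 0) (hpos : ∀ p ∈ B, 0 < p.1) :
    (Quotient.mk isotopySetoid (A ∪ B) : IsotopyClass) =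
      disjointUnion (Quotient.mk isotopySetoid A) (Quotient.mk isotopySetoid B) := by
  obtain ⟨P, hP, rfl⟩ := exists_intoLeft_image_eq hA hneg
  obtain ⟨Q, hQ, rfl⟩ := exists_intoRight_image_eq hB hpos
  rw [← Quotient.sound (s := isotopySetoid) (isotopic_intoLeft hP),
    ← Quotient.sound (s := isotopySetoid) (isotopic_intoRight hQ)]
  rfl

theorem mk_union_of_disjoint_image_snd {A B : Set Space} (hA : IsCompact A) (hB : IsCompact B)
    (h : Disjoint (Prod.snd '' A) (Prod.snd '' B)) :
    (Quotient.mk isotopySetoid (A ∪ B) : IsotopyClass) =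
      disjointUnion (Quotient.mk isotopySetoid B) (Quotient.mk isotopySetoid A) := by
  obtain ⟨R, hR⟩ := (hA.union hB).isBounded.exists_norm_le
  have hfst {p : Space} (hp : p ∈ A ∪ B) : -R ≤ p.1 ∧ p.1 ≤ R :=
    abs_le.1 ((norm_fst_le p).trans (hR p hp))
  let u : Space := (R + 1, 0, 0)
  let v : Space := (-2 * (R + 1), 0, 0)
  have hBv : IsCompact ((· + v) '' B) := hB.image (continuous_add_const v)
  have hsweep : Disjoint A (sweep v B) := by
    refine Set.disjoint_left.2 fun a ha hsw => ?_
    obtain ⟨b, hb, t, -, rfl⟩ := mem_sweep.1 hsw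
    exact Set.disjoint_left.1 h ⟨_, ha, by simp [v]⟩ ⟨b, hb, rfl⟩
  have hmove : Isotopic (A ∪ B) ((· + u) '' ((· + v) '' B) ∪ (· + u) '' A) := by
    rw [← Set.image_union, Set.union_comm _ A]
    exact (Isotopic.union_translate hA hB hsweep).trans (Isotopic.translate (hA.union hBv) u)
  have hBvu : Isotopic B ((· + u) '' ((· + v) '' B)) :=
    (Isotopic.translate hB v).trans (Isotopic.translate hBv u)
  rw [Quotient.sound (s := isotopySetoid) hmove, mk_union_of_neg_of_pos
    (hBv.image (continuous_add_const u)) (hA.image (continuous_add_const u)),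
    ← Quotient.sound (s := isotopySetoid) hBvu,
    ← Quotient.sound (s := isotopySetoid) (Isotopic.translate hA u)]
  · rintro _ ⟨_, ⟨p, hp, rfl⟩, rfl⟩
    have := hfst (Or.inr hp)
    simp only [u, v, Prod.fst_add]
    linarith
  · rintro _ ⟨p, hp, rfl⟩
    have := hfst (Or.inl hp)
    simp only [u, Prod.fst_add]
    linarith

/-- Two overlapping parts split if one of them can be pushed off the other in a direction parallel
to the splitting plane: far out in that direction, it can be moved past the other one. -/
theorem mk_union_of_disjoint_sweep {A B : Set Space} (hA : IsCompact A) (hB : IsCompact B)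
    {e : ℝ × ℝ} (he : e ≠ 0) (h : Disjoint A (sweep (0, e) B)) :
    (Quotient.mk isotopySetoid (A ∪ B) : IsotopyClass) =
      disjointUnion (Quotient.mk isotopySetoid B) (Quotient.mk isotopySetoid A) := by
  obtain ⟨R, hR⟩ := (hA.union hB).isBounded.exists_norm_le
  have hsnd {p : Space} (hp : p ∈ A ∪ B) : ‖p.2‖ ≤ R := (norm_snd_le p).trans (hR p hp)
  obtain ⟨M, hM⟩ := exists_nat_gt (2 * R / ‖e‖)
  rw [div_lt_iff₀ (norm_pos_iff.2 he)] at hM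
  let v : Space := (M : ℝ) • (0, e)
  have hBv : IsCompact ((· + v) '' B) := hB.image (continuous_add_const v)
  have hsweep : Disjoint A (sweep v B) := by
    refine h.mono_right fun p hp => ?_
    obtain ⟨b, hb, t, ht, rfl⟩ := mem_sweep.1 hp
    rw [smul_smul]
    exact add_smul_mem_sweep (subset_sweep _ _ hb) (mul_nonneg ht M.cast_nonneg)
  have hfar : Disjoint (Prod.snd '' A) (Prod.snd '' ((· + v) '' B)) := by
    refine Set.disjoint_left.2 ?_
    rintro _ ⟨a, ha, hab⟩ ⟨_, ⟨b, hb, rfl⟩, rfl⟩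
    have hMe : (M : ℝ) • e = a.2 - b.2 := eq_sub_of_add_eq' hab.symm
    have hnorm : M * ‖e‖ = ‖a.2 - b.2‖ := by rw [← hMe, norm_smul, Real.norm_natCast]
    linarith [norm_sub_le a.2 b.2, hsnd (Or.inl ha), hsnd (Or.inr hb)]
  rw [Quotient.sound (s := isotopySetoid) (Isotopic.union_translate hA hB hsweep),
    mk_union_of_disjoint_image_snd hA hBv hfar,
    ← Quotient.sound (s := isotopySetoid) (Isotopic.translate hB v)]

end IsotopyClass

/-! ### Stretching diagrams -/

theorem exists_orderIso_of_bounds {p q k a b : ℝ} (hpq : p ≤ q) (ha : q + 1 + k ≤ a)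
    (hb : b ≤ p - 1 + k) :
    ∃ ψ : ℝ ≃o ℝ, (∀ x ∈ Set.Icc p q, ψ x = x + k) ∧ ψ (q + 1) = a ∧ ψ (p - 1) = b := by
  obtain ⟨α, hα, rfl⟩ := exists_nonneg_add_of_le ha
  obtain ⟨β, hβ, rfl⟩ : ∃ β, 0 ≤ β ∧ b = p - 1 + k - β :=
    ⟨p - 1 + k - b, sub_nonneg.2 hb, (sub_sub_cancel _ _).symm⟩
  let f := fun x => x + (k + (α * max 0 (x - q) - β * max 0 (p - x)))
  have hmono : StrictMono f := by
    refine strictMono_id.add_monotone fun x y hxy => ?_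
    gcongr
  have htop : Filter.Tendsto f Filter.atTop Filter.atTop := by
    refine Filter.tendsto_atTop_mono' _ ?_
      (Filter.tendsto_atTop_add_const_right _ k Filter.tendsto_id)
    filter_upwards [Filter.eventually_ge_atTop p] with x hx
    have h : 0 ≤ α * max 0 (x - q) := by positivity
    simp only [f, max_eq_left (sub_nonpos.2 hx), id]
    linarith
  have hbot : Filter.Tendsto f Filter.atBot Filter.atBot := by
    refine Filter.tendsto_atBot_mono' _ ?_
      (Filter.tendsto_atBot_add_const_right _ k Filter.tendsto_id)
    filter_upwards [Filter.eventually_le_atBot q] with x hx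
    have h : 0 ≤ β * max 0 (p - x) := by positivity
    simp only [f, max_eq_left (sub_nonpos.2 hx), id]
    linarith
  refine ⟨hmono.orderIsoOfSurjective f (Continuous.surjective (by fun_prop) htop hbot),
    fun x hx => ?_, ?_, ?_⟩
  · change f x = x + k
    simp only [f, max_eq_left (sub_nonpos.2 hx.1), max_eq_left (sub_nonpos.2 hx.2)]
    ring
  · change f (q + 1) = q + 1 + k + α
    simp only [f, add_sub_cancel_left, max_eq_right zero_le_one,
      max_eq_left (by linarith : p - (q + 1) ≤ 0)]
    ring
  · change f (p - 1) = p - 1 + k - β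
    simp only [f, sub_sub_cancel, max_eq_right zero_le_one,
      max_eq_left (by linarith : p - 1 - q ≤ 0)]
    ring

/-- The map that applies `φ` and `ψ` to the coordinates of the plane of the diagram. -/
def stretch (φ ψ : ℝ ≃o ℝ) (p : Space) : Space := (φ p.1, ψ p.2.1, p.2.2)

/-- The reflection of the plane of the diagram in the line `y = 0`. -/
def reflect (p : Space) : Space := (p.1, -p.2.1, p.2.2)

/-- The conjugate of `ψ` by the reflection in `0`. -/
def negConj (ψ : ℝ ≃o ℝ) : ℝ ≃o ℝ where
  toFun y := -ψ (-y)
  invFun y := -ψ.symm (-y)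
  left_inv y := by simp
  right_inv y := by simp
  map_rel_iff' := by simp

theorem stretch_comp_reflect (φ ψ : ℝ ≃o ℝ) :
    stretch φ ψ ∘ reflect = reflect ∘ stretch φ (negConj ψ) := by
  funext p
  simp [stretch, reflect, negConj]

theorem isotopic_stretch {K : Set Space} (hK : IsCompact K) (φ ψ : ℝ ≃o ℝ) :
    Isotopic K (stretch φ ψ '' K) := by
  have hφ := φ.continuous
  have h := (Isotopic.map_fst hK φ.strictMono φ.continuous).trans
    (Isotopic.map_snd (hK.image (by fun_prop)) ψ.strictMono ψ.continuous)
  rwa [← Set.image_comp] at h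

theorem mem_image_stretch {φ ψ : ℝ ≃o ℝ} {K : Set Space} {p : Space} :
    p ∈ stretch φ ψ '' K ↔ (φ.symm p.1, ψ.symm p.2.1, p.2.2) ∈ K := by
  constructor
  · rintro ⟨q, hq, rfl⟩
    simpa [stretch] using hq
  · intro h
    exact ⟨_, h, by simp [stretch]⟩

theorem image_column (φ ψ : ℝ ≃o ℝ) (x a b : ℝ) :
    stretch φ ψ '' column x a b = column (φ x) (ψ a) (ψ b) := by
  ext p
  rw [mem_image_stretch]
  simp [column, OrderIso.symm_apply_eq, OrderIso.le_symm_apply, OrderIso.symm_apply_le]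

theorem image_bridge (c : CrossingRule) (φ ψ : ℝ ≃o ℝ) (y a b : ℝ) :
    stretch φ ψ '' bridge c y a b = bridge c (ψ y) (φ a) (φ b) := by
  ext p
  rw [mem_image_stretch]
  simp [bridge, OrderIso.symm_apply_eq, OrderIso.le_symm_apply, OrderIso.symm_apply_le]

theorem isCompact_column (x a b : ℝ) : IsCompact (column x a b) := by
  have : column x a b = {x} ×ˢ Set.Icc a b ×ˢ {0} := by
    ext p
    simp [column]
  rw [this]
  exact isCompact_singleton.prod (isCompact_Icc.prod isCompact_singleton)

theorem fst_mem_Icc_of_mem_bridge {c : CrossingRule} {y a b : ℝ} (hab : a ≤ b) {p : Space}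
    (hp : p ∈ bridge c y a b) : p.1 ∈ Set.Icc a b := by
  rcases hp.2 with ⟨hx, -⟩ | ⟨hx | hx, -⟩
  · exact hx
  · exact ⟨hx.ge, hx.le.trans hab⟩
  · exact ⟨hab.trans hx.ge, hx.le⟩

theorem eq_level_of_mem_bridge {c : CrossingRule} {y a b : ℝ} {p : Space}
    (hp : p ∈ bridge c y a b) (ha : a < p.1) (hb : p.1 < b) : p.2.2 = c.level := by
  rcases hp.2 with ⟨-, hz⟩ | ⟨hx | hx, -⟩
  · exact hz
  · exact absurd hx ha.ne'
  · exact absurd hx hb.ne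

theorem isCompact_bridge (c : CrossingRule) (y a b : ℝ) : IsCompact (bridge c y a b) := by
  have : bridge c y a b = Set.Icc a b ×ˢ {y} ×ˢ {c.level} ∪
      {a, b} ×ˢ {y} ×ˢ Set.uIcc 0 c.level := by
    ext p
    simp only [bridge, Set.mem_ofPred_eq, Set.mem_union, Set.mem_prod, Set.mem_singleton_iff,
      Set.mem_insert_iff]
    tauto
  rw [this]
  exact (isCompact_Icc.prod (isCompact_singleton.prod isCompact_singleton)).union
    ((Set.toFinite _).isCompact.prod (isCompact_singleton.prod isCompact_uIcc))

theorem continuous_reflect : Continuous reflect := by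
  unfold reflect
  fun_prop

theorem reflect_bridge (c : CrossingRule) (y a b : ℝ) :
    reflect '' bridge c y a b = bridge c (-y) a b := by
  ext ⟨u, v, w⟩
  constructor
  · rintro ⟨q, ⟨h1, h2⟩, h⟩
    obtain ⟨rfl, rfl, rfl⟩ : q.1 = u ∧ -q.2.1 = v ∧ q.2.2 = w := by
      simpa [reflect] using h
    exact ⟨neg_inj.2 h1, h2⟩
  · rintro ⟨h1, h2⟩
    exact ⟨(u, -v, w), ⟨neg_eq_iff_eq_neg.2 h1, h2⟩, by simp [reflect]⟩

theorem column_union_reflect (x : ℝ) {a b : ℝ} (ha : 0 ≤ a) (hb : 0 ≤ b) :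
    column x 0 b ∪ reflect '' column x 0 a = column x (-a) b := by
  ext ⟨u, v, w⟩
  simp only [Set.mem_union, Set.mem_image, column, reflect, Set.mem_ofPred_eq, Set.mem_Icc]
  constructor
  · rintro (⟨h1, ⟨h2, h3⟩, h4⟩ | ⟨q, ⟨h1, ⟨h2, h3⟩, h4⟩, h⟩)
    · exact ⟨h1, ⟨by linarith, h3⟩, h4⟩
    · simp only [Prod.mk.injEq] at h
      obtain ⟨r1, r2, r3⟩ := h
      exact ⟨by linarith, ⟨by linarith, by linarith⟩, by linarith⟩
  · rintro ⟨h1, ⟨h2, h3⟩, h4⟩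
    rcases le_total 0 v with h | h
    · exact Or.inl ⟨h1, ⟨h, h3⟩, h4⟩
    · exact Or.inr ⟨(u, -v, w), ⟨h1, ⟨by simpa using h, by simp; linarith⟩, h4⟩, by simp⟩

namespace TernaryTree

theorem rootColumn_lt (T : TernaryTree) : T.rootColumn < T.numLeaves := by
  induction T with
  | leaf => exact Nat.one_pos
  | node l m r _ hm _ => simp only [rootColumn, numLeaves]; omega

theorem isCompact_draw (c : CrossingRule) (T : TernaryTree) (k y : ℕ) :
    IsCompact (T.draw c k y) := by
  induction T generalizing k y with
  | leaf => exact isCompact_column _ _ _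
  | node l m r hl hm hr =>
    exact (((hl _ _).union (hm _ _)).union (hr _ _)).union (isCompact_bridge _ _ _ _)

theorem height_lt_node_left (l m r : TernaryTree) : l.height < (node l m r).height :=
  Nat.lt_succ_of_le (le_max_left _ _)

theorem height_lt_node_middle (l m r : TernaryTree) : m.height < (node l m r).height :=
  Nat.lt_succ_of_le ((le_max_left _ _).trans (le_max_right _ _))

theorem height_lt_node_right (l m r : TernaryTree) : r.height < (node l m r).height :=
  Nat.lt_succ_of_le ((le_max_right _ _).trans (le_max_right _ _))

theorem image_draw (c : CrossingRule) {φ ψ : ℝ ≃o ℝ} (T : TernaryTree) {k k' y y' : ℕ}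
    (hφ : ∀ i < T.numLeaves, φ ((k + i : ℕ) : ℝ) = ((k' + i : ℕ) : ℝ))
    (hψ : ∀ j ≤ T.height, ψ (j : ℝ) = j) (hy : ψ y = y') :
    stretch φ ψ '' T.draw c k y = T.draw c k' y' := by
  induction T generalizing k k' y y' with
  | leaf =>
    have hx : φ (k : ℝ) = k' := hφ 0 Nat.one_pos
    have hbase : ψ 0 = 0 := by simpa using hψ 0 le_rfl
    rw [draw, draw, image_column, hx, hbase, hy]
  | node l m r hl hm hr =>
    simp only [numLeaves] at hφ
    have hroot := hψ _ le_rfl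
    have hleft := l.rootColumn_lt
    have hright := r.rootColumn_lt
    have hrootl := hφ l.rootColumn (by omega)
    have hrootr := hφ (l.numLeaves + m.numLeaves + r.rootColumn) (by omega)
    simp only [← add_assoc] at hrootr
    simp only [draw, Set.image_union, image_bridge]
    rw [hl (fun i hi => hφ i (by omega))
        (fun j hj => hψ j (hj.trans (height_lt_node_left l m r).le)) hroot,
      hm (fun i hi => by simpa only [← add_assoc] using hφ (l.numLeaves + i) (by omega))
        (fun j hj => hψ j (hj.trans (height_lt_node_middle l m r).le)) hy,
      hr (fun i hi => by
          simpa only [← add_assoc] using hφ (l.numLeaves + m.numLeaves + i) (by omega))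
        (fun j hj => hψ j (hj.trans (height_lt_node_right l m r).le)) hroot,
      hroot, hrootl, hrootr]

/-- The drawings of two trees with first leaves at `x = k`, whose roots at the heights `Y` and
`-Y'` are joined by an arc through the column `X`. -/
def closedDiagram (c : CrossingRule) (T S : TernaryTree) (k Y Y' X : ℕ) : Set Space :=
  T.draw c k Y ∪ reflect '' S.draw c k Y' ∪
  (bridge c Y ((k + T.rootColumn : ℕ) : ℝ) X ∪ column X (-Y') Y ∪
    bridge c (-Y') ((k + S.rootColumn : ℕ) : ℝ) X)

theorem isCompact_closedDiagram (c : CrossingRule) (T S : TernaryTree) (k Y Y' X : ℕ) :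
    IsCompact (closedDiagram c T S k Y Y' X) :=
  ((isCompact_draw c T k Y).union ((isCompact_draw c S k Y').image continuous_reflect)).union
    (((isCompact_bridge _ _ _ _).union (isCompact_column _ _ _)).union (isCompact_bridge _ _ _ _))

theorem link_eq_closedDiagram (c : CrossingRule) (T S : TernaryTree) :
    T.link c S = closedDiagram c T S 0 (T.height + 1) (S.height + 1) T.numLeaves := by
  unfold link closedDiagram
  push_cast
  simp only [zero_add]
  rfl

theorem image_closedDiagram (c : CrossingRule) {φ ψ : ℝ ≃o ℝ} {T S : TernaryTree}
    (hn : T.numLeaves = S.numLeaves) {k Y Y' X k' Z Z' X' : ℕ}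
    (hφ : ∀ i < T.numLeaves, φ ((k + i : ℕ) : ℝ) = ((k' + i : ℕ) : ℝ)) (hX : φ X = X')
    (hψT : ∀ j ≤ T.height, ψ (j : ℝ) = j) (hψS : ∀ j ≤ S.height, ψ (-j : ℝ) = -j)
    (hY : ψ Y = Z) (hY' : ψ (-Y') = -Z') :
    stretch φ ψ '' closedDiagram c T S k Y Y' X = closedDiagram c T S k' Z Z' X' := by
  have hS : stretch φ (negConj ψ) '' S.draw c k Y' = S.draw c k' Z' :=
    image_draw c S (hn ▸ hφ) (fun j hj => neg_eq_iff_eq_neg.2 (hψS j hj)) (neg_eq_iff_eq_neg.2 hY')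
  unfold closedDiagram
  simp only [Set.image_union]
  rw [← Set.image_comp (stretch φ ψ) reflect, stretch_comp_reflect, Set.image_comp, hS,
    image_draw c T hφ hψT hY, image_bridge, image_bridge, image_column, hY, hY', hX,
    hφ _ T.rootColumn_lt, hφ _ (hn ▸ S.rootColumn_lt)]

theorem isotopic_link_closedDiagram (c : CrossingRule) {T S : TernaryTree}
    (hn : T.numLeaves = S.numLeaves) {k Y Y' X : ℕ} (hY : T.height < Y) (hY' : S.height < Y')
    (hX : k + T.numLeaves ≤ X) : Isotopic (T.link c S) (closedDiagram c T S k Y Y' X) := by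
  have hX' : (k + T.numLeaves : ℝ) ≤ X := mod_cast hX
  have hYT : (T.height + 1 : ℝ) ≤ Y := mod_cast hY
  have hYS : (S.height + 1 : ℝ) ≤ Y' := mod_cast hY'
  have hleaves : (1 : ℝ) ≤ T.numLeaves := mod_cast T.numLeaves_pos
  have hneg (m n : ℕ) : -(m : ℝ) ≤ n := (neg_nonpos.2 m.cast_nonneg).trans n.cast_nonneg
  obtain ⟨φ, hφ, hφX, -⟩ := exists_orderIso_of_bounds (p := 0) (q := T.numLeaves - 1) (k := k)
    (a := X) (by linarith) (by linarith) le_rfl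
  obtain ⟨ψ, hψ, hψY, hψY'⟩ := exists_orderIso_of_bounds (p := -S.height) (q := T.height) (k := 0)
    (a := Y) (b := -Y') (hneg _ _) (by linarith) (by linarith)
  have himage : stretch φ ψ '' closedDiagram c T S 0 (T.height + 1) (S.height + 1) T.numLeaves =
      closedDiagram c T S k Y Y' X := by
    refine image_closedDiagram c hn (fun i hi => ?_) (by rwa [sub_add_cancel] at hφX)
      (fun j hj => ?_) (fun j hj => ?_) (by push_cast; exact hψY)
      (by push_cast; rwa [neg_add'])
    · have hi' : (i + 1 : ℝ) ≤ T.numLeaves := mod_cast hi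
      rw [hφ _ ⟨by positivity, by push_cast; linarith⟩]
      push_cast
      ring
    · have hj' : (j : ℝ) ≤ T.height := mod_cast hj
      rw [hψ _ ⟨hneg _ _, hj'⟩, add_zero]
    · have hj' : (j : ℝ) ≤ S.height := mod_cast hj
      rw [hψ _ ⟨neg_le_neg hj', hneg _ _⟩, add_zero]
  rw [link_eq_closedDiagram, ← himage]
  exact isotopic_stretch (isCompact_closedDiagram _ _ _ _ _ _ _) φ ψ

theorem link_node_leaf (c : CrossingRule) {A A' B B' : TernaryTree}
    (hA : A.numLeaves = A'.numLeaves) (hB : B.numLeaves = B'.numLeaves) :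
    (node A B leaf).link c (node A' B' leaf) =
      closedDiagram c A A' 0 (node A B leaf).height (node A' B' leaf).height
        (A.numLeaves + B.numLeaves) ∪
      closedDiagram c B B' A.numLeaves ((node A B leaf).height + 1)
        ((node A' B' leaf).height + 1) (A.numLeaves + B.numLeaves + 1) := by
  have e1 : (node A' B' leaf).draw c 0 ((node A' B' leaf).height + 1) =
      A'.draw c 0 (node A' B' leaf).height ∪
      B'.draw c A.numLeaves ((node A' B' leaf).height + 1) ∪
      column ((A.numLeaves + B.numLeaves : ℕ) : ℝ) 0 (node A' B' leaf).height ∪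
      bridge c (node A' B' leaf).height ((0 + A'.rootColumn : ℕ) : ℝ)
        ((A.numLeaves + B.numLeaves : ℕ) : ℝ) := by
    simp only [draw, rootColumn, zero_add, add_zero, hA, hB]
  have e2 : (node A B leaf).draw c 0 ((node A B leaf).height + 1) =
      A.draw c 0 (node A B leaf).height ∪
      B.draw c A.numLeaves ((node A B leaf).height + 1) ∪
      column ((A.numLeaves + B.numLeaves : ℕ) : ℝ) 0 (node A B leaf).height ∪
      bridge c (node A B leaf).height ((0 + A.rootColumn : ℕ) : ℝ)
        ((A.numLeaves + B.numLeaves : ℕ) : ℝ) := by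
    simp only [draw, rootColumn, zero_add, add_zero]
  rw [link_eq_closedDiagram]
  unfold closedDiagram
  rw [e1, e2, ← column_union_reflect ((A.numLeaves + B.numLeaves : ℕ) : ℝ)
    (Nat.cast_nonneg (node A' B' leaf).height) (Nat.cast_nonneg (node A B leaf).height)]
  simp only [Set.image_union, reflect_bridge, rootColumn, numLeaves, zero_add, ← hA]
  ext p
  simp only [Set.mem_union]
  tauto

/-! ### Overlaps of diagrams -/

theorem fst_mem_Icc_of_mem_draw {c : CrossingRule} {T : TernaryTree} {k y : ℕ} {p : Space}
    (hp : p ∈ T.draw c k y) : p.1 ∈ Set.Icc (k : ℝ) (k + T.numLeaves - 1) := by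
  induction T generalizing k y with
  | leaf => simp [numLeaves, hp.1]
  | node l m r hl hm hr =>
    have hrootl : (l.rootColumn + 1 : ℝ) ≤ l.numLeaves := mod_cast l.rootColumn_lt
    have hrootr : (r.rootColumn + 1 : ℝ) ≤ r.numLeaves := mod_cast r.rootColumn_lt
    have hnat (n : ℕ) : (0 : ℝ) ≤ n := n.cast_nonneg
    have hsum : ((node l m r).numLeaves : ℝ) = l.numLeaves + m.numLeaves + r.numLeaves := by
      push_cast [numLeaves]
      ring
    suffices h : (k : ℝ) ≤ p.1 ∧ p.1 ≤ k + (l.numLeaves + m.numLeaves + r.numLeaves : ℝ) - 1 by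
      rwa [hsum]
    rcases hp with ((hp | hp) | hp) | hp
    · obtain ⟨h1, h2⟩ := hl hp
      constructor <;> linarith [hnat m.numLeaves, hnat r.numLeaves]
    · obtain ⟨h1, h2⟩ := hm hp
      push_cast at h1 h2
      constructor <;> linarith [hnat l.numLeaves, hnat r.numLeaves]
    · obtain ⟨h1, h2⟩ := hr hp
      push_cast at h1 h2
      constructor <;> linarith [hnat l.numLeaves, hnat m.numLeaves]
    · have hle : k + l.rootColumn ≤ k + l.numLeaves + m.numLeaves + r.rootColumn := by
        have := l.rootColumn_lt
        omega
      obtain ⟨h1, h2⟩ := fst_mem_Icc_of_mem_bridge (mod_cast hle) hp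
      push_cast at h1 h2
      constructor <;> linarith [hnat l.rootColumn]

theorem snd_mem_Icc_of_mem_draw {c : CrossingRule} {T : TernaryTree} {k y : ℕ}
    (hy : T.height ≤ y) {p : Space} (hp : p ∈ T.draw c k y) :
    p.2.1 ∈ Set.Icc (0 : ℝ) y := by
  induction T generalizing k y with
  | leaf => exact hp.2.1
  | node l m r hl hm hr =>
    have hcast : ((node l m r).height : ℝ) ≤ y := mod_cast hy
    rcases hp with ((hp | hp) | hp) | hp
    · exact Set.Icc_subset_Icc_right hcast (hl (height_lt_node_left l m r).le hp)
    · exact hm ((height_lt_node_middle l m r).le.trans hy) hp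
    · exact Set.Icc_subset_Icc_right hcast (hr (height_lt_node_right l m r).le hp)
    · rw [hp.1]
      exact ⟨Nat.cast_nonneg _, hcast⟩

theorem le_height_or_eq_zero_of_mem_draw {c : CrossingRule} {T : TernaryTree} {k y : ℕ}
    {p : Space} (hp : p ∈ T.draw c k y) : p.2.1 ≤ T.height ∨ p.2.2 = 0 := by
  induction T generalizing k y with
  | leaf => exact Or.inr hp.2.2
  | node l m r _ hm _ =>
    rcases hp with ((hp | hp) | hp) | hp
    · exact Or.inl (snd_mem_Icc_of_mem_draw (height_lt_node_left l m r).le hp).2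
    · exact (hm hp).imp_left fun h => h.trans (mod_cast (height_lt_node_middle l m r).le)
    · exact Or.inl (snd_mem_Icc_of_mem_draw (height_lt_node_right l m r).le hp).2
    · exact Or.inl hp.1.le

variable {c : CrossingRule} {T S : TernaryTree} {k Y Y' X : ℕ} {p : Space}

theorem fst_mem_Icc_of_mem_closedDiagram (hn : T.numLeaves = S.numLeaves)
    (hX : k + T.numLeaves ≤ X) (hp : p ∈ closedDiagram c T S k Y Y' X) :
    p.1 ∈ Set.Icc (k : ℝ) X := by
  have hX' : (k + T.numLeaves : ℝ) ≤ X := mod_cast hX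
  have hkX : (k : ℝ) ≤ X := mod_cast (Nat.le_add_right _ _).trans hX
  have hdraw : Set.Icc (k : ℝ) (k + T.numLeaves - 1) ⊆ Set.Icc (k : ℝ) X :=
    Set.Icc_subset_Icc_right (by linarith)
  have harc {r : ℕ} {y : ℝ} (hr : r < T.numLeaves) (h : p ∈ bridge c y ((k + r : ℕ) : ℝ) X) :
      p.1 ∈ Set.Icc (k : ℝ) X :=
    Set.Icc_subset_Icc_left (mod_cast Nat.le_add_right k r)
      (fst_mem_Icc_of_mem_bridge (mod_cast (by omega)) h)
  rcases hp with (hp | ⟨q, hq, rfl⟩) | ((hp | hp) | hp)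
  · exact hdraw (fst_mem_Icc_of_mem_draw hp)
  · have h : q.1 ∈ Set.Icc (k : ℝ) (k + S.numLeaves - 1) := fst_mem_Icc_of_mem_draw hq
    exact hdraw (hn ▸ h)
  · exact harc T.rootColumn_lt hp
  · exact ⟨hp.1 ▸ hkX, hp.1.le⟩
  · exact harc (hn ▸ S.rootColumn_lt) hp

theorem snd_mem_Icc_of_mem_closedDiagram (hY : T.height ≤ Y) (hY' : S.height ≤ Y')
    (hp : p ∈ closedDiagram c T S k Y Y' X) : p.2.1 ∈ Set.Icc (-Y' : ℝ) Y := by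
  have hneg : (-Y' : ℝ) ≤ 0 := neg_nonpos.2 Y'.cast_nonneg
  have hle : (-Y' : ℝ) ≤ Y := hneg.trans Y.cast_nonneg
  rcases hp with (hp | ⟨q, hq, rfl⟩) | ((hp | hp) | hp)
  · exact Set.Icc_subset_Icc_left hneg (snd_mem_Icc_of_mem_draw hY hp)
  · obtain ⟨h0, hqY'⟩ := snd_mem_Icc_of_mem_draw hY' hq
    exact ⟨neg_le_neg hqY', (neg_nonpos.2 h0).trans Y.cast_nonneg⟩
  · exact ⟨hle.trans hp.1.ge, hp.1.le⟩
  · exact hp.2.1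
  · exact ⟨hp.1.ge, hp.1.le.trans hle⟩

theorem of_mem_closedDiagram_of_inside_arc (hn : T.numLeaves = S.numLeaves)
    (hY : T.height ≤ Y) (hY' : S.height ≤ Y') (hp : p ∈ closedDiagram c T S k Y Y' X)
    (hpX : p.1 < X) (hpY : p.2.1 ∈ Set.Ioo (-Y' : ℝ) Y) :
    p.1 ≤ k + T.numLeaves - 1 ∧ (p.2.1 ∈ Set.Icc (-S.height : ℝ) T.height ∨ p.2.2 = 0) := by
  rcases hp with (hp | ⟨q, hq, rfl⟩) | ((hp | hp) | hp)
  · refine ⟨(fst_mem_Icc_of_mem_draw hp).2,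
      (le_height_or_eq_zero_of_mem_draw hp).imp_left fun h => ⟨?_, h⟩⟩
    exact (neg_nonpos.2 S.height.cast_nonneg).trans (snd_mem_Icc_of_mem_draw hY hp).1
  · refine ⟨hn ▸ (fst_mem_Icc_of_mem_draw hq).2,
      (le_height_or_eq_zero_of_mem_draw hq).imp_left fun h => ⟨neg_le_neg h, ?_⟩⟩
    exact (neg_nonpos.2 (snd_mem_Icc_of_mem_draw hY' hq).1).trans T.height.cast_nonneg
  · exact absurd hp.1 hpY.2.ne
  · exact absurd hp.1 hpX.ne
  · exact absurd hp.1 hpY.1.ne'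

theorem of_mem_closedDiagram_of_right_of_trees (hn : T.numLeaves = S.numLeaves)
    (hp : p ∈ closedDiagram c T S k Y Y' X) (hpk : k + T.numLeaves - 1 < p.1) (hpX : p.1 < X) :
    (p.2.1 = Y ∨ p.2.1 = -Y') ∧ p.2.2 = c.level := by
  have harc {r : ℕ} {y : ℝ} (hr : r < T.numLeaves) (h : p ∈ bridge c y ((k + r : ℕ) : ℝ) X) :
      p.2.2 = c.level := by
    have hr' : (r + 1 : ℝ) ≤ T.numLeaves := mod_cast hr
    exact eq_level_of_mem_bridge h (by push_cast; linarith) hpX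
  rcases hp with (hp | ⟨q, hq, rfl⟩) | ((hp | hp) | hp)
  · exact absurd (fst_mem_Icc_of_mem_draw hp).2 hpk.not_ge
  · exact absurd (fst_mem_Icc_of_mem_draw hq).2 (hn ▸ hpk.not_ge)
  · exact ⟨Or.inl hp.1, harc T.rootColumn_lt hp⟩
  · exact absurd hp.1 hpX.ne
  · exact ⟨Or.inr hp.1, harc (hn ▸ S.rootColumn_lt) hp⟩

/-- The second diagram starts to the right of the trees of the first one, and its arc encloses the
first one: only the upper and the lower edge of the first arc can cross it, and they do so above
and below all vertices of the second diagram. -/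
theorem eq_level_and_eq_zero_of_overlap {A A' B B' : TernaryTree}
    (hA : A.numLeaves = A'.numLeaves) (hB : B.numLeaves = B'.numLeaves) {h h' : ℕ}
    (hAh : A.height < h) (hBh : B.height < h) (hAh' : A'.height < h') (hBh' : B'.height < h')
    {a b : Space} (ha : a ∈ closedDiagram c A A' 0 h h' (A.numLeaves + B.numLeaves))
    (hb : b ∈ closedDiagram c B B' A.numLeaves (h + 1) (h' + 1) (A.numLeaves + B.numLeaves + 1))
    (hx : a.1 = b.1) (hy : a.2.1 = b.2.1) : a.2.2 = c.level ∧ b.2.2 = 0 := by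
  obtain ⟨-, haX⟩ := fst_mem_Icc_of_mem_closedDiagram hA (by omega) ha
  obtain ⟨hay', hay⟩ := snd_mem_Icc_of_mem_closedDiagram hAh.le hAh'.le ha
  obtain ⟨hbk, -⟩ := fst_mem_Icc_of_mem_closedDiagram hB (by omega) hb
  push_cast at haX
  obtain ⟨hbX, hbz⟩ := of_mem_closedDiagram_of_inside_arc hB (by omega) (by omega) hb
    (by push_cast; linarith) ⟨by push_cast; linarith, by push_cast; linarith⟩
  obtain ⟨hay, haz⟩ := of_mem_closedDiagram_of_right_of_trees hA ha
    (by push_cast; linarith) (by push_cast; linarith)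
  have hBh : (B.height : ℝ) < h := mod_cast hBh
  have hBh' : (B'.height : ℝ) < h' := mod_cast hBh'
  refine ⟨haz, hbz.resolve_left fun hby => ?_⟩
  rcases hay with hay | hay <;> linarith [hby.1, hby.2]

end TernaryTree

theorem CrossingRule.level_ne_zero (c : CrossingRule) : c.level ≠ 0 := by
  cases c <;> simp [CrossingRule.level]

theorem TernaryTree.mk_link_node_leaf (c : CrossingRule) {A A' B B' : TernaryTree}
    (hA : A.numLeaves = A'.numLeaves) (hB : B.numLeaves = B'.numLeaves) :
    (Quotient.mk isotopySetoid ((node A B leaf).link c (node A' B' leaf)) : IsotopyClass) =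
      IsotopyClass.disjointUnion (Quotient.mk isotopySetoid (B.link c B'))
        (Quotient.mk isotopySetoid (A.link c A')) := by
  have hAh := height_lt_node_left A B leaf
  have hAh' := height_lt_node_left A' B' leaf
  have hBh := height_lt_node_middle A B leaf
  have hBh' := height_lt_node_middle A' B' leaf
  have hmkA := Quotient.sound (s := isotopySetoid) (isotopic_link_closedDiagram c hA (k := 0)
    (X := A.numLeaves + B.numLeaves) hAh hAh' (by omega))
  have hmkB := Quotient.sound (s := isotopySetoid) (isotopic_link_closedDiagram c hB
    (k := A.numLeaves) (X := A.numLeaves + B.numLeaves + 1) (hBh.trans (Nat.lt_succ_self _))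
    (hBh'.trans (Nat.lt_succ_self _)) (Nat.le_succ _))
  have he : ((0, -c.level) : ℝ × ℝ) ≠ 0 := by simp [c.level_ne_zero]
  rw [link_node_leaf c hA hB, IsotopyClass.mk_union_of_disjoint_sweep
    (isCompact_closedDiagram _ _ _ _ _ _ _) (isCompact_closedDiagram _ _ _ _ _ _ _) he,
    hmkA, hmkB]
  refine Set.disjoint_left.2 fun a ha hsweep => ?_
  obtain ⟨b, hb, t, ht, rfl⟩ := mem_sweep.1 hsweep
  obtain ⟨haz, hbz⟩ := eq_level_and_eq_zero_of_overlap hA hB hAh hBh hAh' hBh' ha hb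
    (by simp) (by simp)
  have hlevel : (t + 1) * c.level = 0 := by
    simp only [Prod.smul_mk, smul_eq_mul, mul_zero, mul_neg, Prod.snd_add, hbz, zero_add] at haz
    linarith
  exact (mul_ne_zero (by positivity) c.level_ne_zero) hlevel

theorem F3.jonesLink_sqcup (c : CrossingRule) {f : F3} (g : F3) (hf : f ≠ 1) :
    jonesLink c (sqcup f g) = IsotopyClass.disjointUnion (jonesLink c f) (jonesLink c g) := by
  rw [jonesLink, reducedPair_sqcup g hf]
  exact TernaryTree.mk_link_node_leaf c g.reducedPair_spec.1.numLeaves_eq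
    f.reducedPair_spec.1.numLeaves_eq

theorem mainTheorem7 :
    (∀ f g : F3,
      F3.sqcup f g = F3.phi [1] f * F3.phi [0] g ∧
      F3.sqcup f g = F3.phi [0] g * F3.phi [1] f) ∧
    (∀ (c : CrossingRule) (f g : F3), f ≠ 1 → g ≠ 1 →
      F3.jonesLink c (F3.sqcup f g) =
        IsotopyClass.disjointUnion (F3.jonesLink c f) (F3.jonesLink c g)) ∧
    (∀ f f' g g' : F3,
      F3.sqcup (f * f') (g * g') = F3.sqcup f g * F3.sqcup f' g') :=
  ⟨fun f g => ⟨rfl, F3.phi_one_commute_phi_zero f g⟩, fun c _ g hf _ => F3.jonesLink_sqcup c g hf,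
    F3.sqcup_mul⟩
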